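/- Let $\mathbb{H}$ be a real separable Hilbert space, $(\Omega,\mathcal{A},\mathbb{P})$ a probability space, $T:\Omega\to\Omega$ a bijective bimeasurable transformation preserving $\mathbb{P}$, and $\mathcal{F}_0\subseteq\mathcal{A}$ a $\sigma$-field with $\mathcal{F}_0\subseteq T^{-1}(\mathcal{F}_0)$. Let $X_0:\Omega\to\mathbb{H}$ be an $\mathcal{F}_0$-measurable random variable with $\|\|X_0\|_{\mathbb{H}}\|_\infty<\infty$ (essential supremum of the norm) and $\mathbb{E}(X_0)=0$. Put $X_i=X_0\circ T^i$ for $i\in\mathbb{Z}$, $S_n=\sum_{j=1}^n X_j$, and $$\phi_1(j)=\sup_{A\in\mathcal{B}(\mathbb{H})}\big\|\mathbb{P}(X_j\in A\mid\mathcal{F}_0)-\mathbb{P}(X_j\in A)\big\|_\infty .$$ Let $C$ be the absolute constant $C=\max\{D,D'\}$ with $7D=40\sqrt2+27$ and $7D'=24\sqrt2+12$. Then for every integer $n\ge 1$ and every real $x\ge 0$, $$\mathbb{P}\Big(\max_{1\le i\le n}\|S_i\|_{\mathbb{H}}\ge x\Big)\le 2\sqrt{e}\,\exp\left(-\frac{x^2}{4n\,\|\|X_0\|_{\mathbb{H}}\|_\infty^2\big(1+6C\sum_{j\ge1}j^{-1/2}\phi_1(j)\big)^2}\right).$$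 Here $\sum_{j\ge1}j^{-1/2}\phi_1(j)\in[0,\infty]$, and the conventions are $a/\infty=0$ for $0\le a<\infty$, $a/0=\infty$ for $a>0$, $0/0=0$, and $\exp(-\infty)=0$. -/

import Mathlib

open MeasureTheory ProbabilityTheory

open scoped ENNReal

noncomputable section

namespace PhiMixing

/-- The sequence `X_i = X₀ ∘ T^i`, `i ∈ ℤ`, for a bijective bimeasurable `T`. -/
def seq {Ω H : Type*} [MeasurableSpace Ω] (T : Ω ≃ᵐ Ω) (X₀ : Ω → H) (i : ℤ) (ω : Ω) : H :=
  X₀ ((T.toEquiv ^ i : Equiv.Perm Ω) ω)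

/-- The partial sums `S_n = X_1 + ⋯ + X_n`. -/
def partialSum {Ω H : Type*} [MeasurableSpace Ω] [AddCommMonoid H] (T : Ω ≃ᵐ Ω) (X₀ : Ω → H)
    (n : ℕ) (ω : Ω) : H :=
  ∑ j ∈ Finset.Icc 1 n, seq T X₀ (j : ℤ) ω

/-- The `φ`-mixing coefficient `φ(𝓕, σ(Y)) = sup_A ‖P(Y ∈ A | 𝓕) - P(Y ∈ A)‖_∞`, the supremum
being over all measurable sets `A` and `‖·‖_∞` the essential supremum norm. -/
def phiCoeff {Ω E : Type*} (𝓕 : MeasurableSpace Ω) [MeasurableSpace Ω] [MeasurableSpace E]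
    (P : Measure Ω) (Y : Ω → E) : ℝ≥0∞ :=
  ⨆ (A : Set E) (_ : MeasurableSet A),
    eLpNorm (fun ω => (P⟦Y ⁻¹' A | 𝓕⟧) ω - P.real (Y ⁻¹' A)) ∞ P

/-- `φ₁(n) = φ(𝓕₀, σ(X_n))`. -/
def phiOne {Ω H : Type*} (𝓕₀ : MeasurableSpace Ω) [MeasurableSpace Ω] [MeasurableSpace H]
    (P : Measure Ω) (T : Ω ≃ᵐ Ω) (X₀ : Ω → H) (n : ℕ) : ℝ≥0∞ :=
  phiCoeff 𝓕₀ P (seq T X₀ (n : ℤ))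

/-- The series `∑_{j ≥ 1} j^{-1/2} φ₁(j)`, possibly infinite. -/
def phiSeries {Ω H : Type*} (𝓕₀ : MeasurableSpace Ω) [MeasurableSpace Ω] [MeasurableSpace H]
    (P : Measure Ω) (T : Ω ≃ᵐ Ω) (X₀ : Ω → H) : ℝ≥0∞ :=
  ∑' j : ℕ, ENNReal.ofReal (((j + 1 : ℕ) : ℝ) ^ (-(1 / 2) : ℝ)) * phiOne 𝓕₀ P T X₀ (j + 1)

/-- The absolute constant `C = max {D, D'}` of the maximal Hoeffding inequality, where
`7 D = 40 √2 + 27` and `7 D' = 24 √2 + 12`. -/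
def hoeffdingConst : ℝ := max ((40 * √2 + 27) / 7) ((24 * √2 + 12) / 7)

end PhiMixing

end

/-!
The proof splits the partial sums into a short list of Hilbert-space martingales and controls the
exponential moments of their maxima.

A martingale `M` with increments bounded by `c` satisfies `E cosh ‖M_n‖ ≤ exp (n c² / 2)`
(`IsBddMartDiff.integral_cosh_le`). This rests on the convexity of `u ↦ cosh √u`: it bounds
`cosh ‖x + d‖` by `cosh c * cosh ‖x‖` plus a term linear in the increment `d`, whose mean is zero
(`cosh_norm_add_le`). A pathwise form of Doob's `L²` inequality (`sq_partialSups_le`), applied to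
`exp (‖M_k‖ / 2)`, turns this into `E exp (t max_k ‖M_k‖) ≤ 8 exp (n t² c² / 2)`. Bounds of this
shape add in scale, whatever the dependence (`ExpSqBound.add`).

For the sequence itself, subtracting `E(X_i | F_{i-1})` from each `X_i` leaves one martingale, with
increments bounded by `‖X₀‖_∞` plus a prediction term. The remaining predictable terms are
summed in pairs, each pair is replaced by its conditional expectation given the past at its left
endpoint, the difference is again a martingale with half as many terms, and so on over dyadic blocks
of length `2 ^ j` (`IsCondBdd.blockProj_add`, `IsCondBdd.expSqBound_blockProj`). If `θ k` bounds
`E(X_{m+k+1} | F_m)`, the block of level `j` contributes `√n 2^{-j/2} ∑_{k < 2^j} θ k` to the scale,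
and summing over `j` gives `√n (‖X₀‖_∞ + 12 ∑_k (k + 1)^{-1/2} θ k)` (`IsCondBdd.expSqBound_sum`,
`sum_sqrt_half_pow_mul_sum_le`).

The mixing coefficient enters through `θ k = 2 ‖X₀‖_∞ φ₁(k + 1)` (`setIntegral_le_of_phiCoeff`,
`isCondBdd_seq`), so the scale is at most `√n ‖X₀‖_∞ (1 + 24 ∑_j j^{-1/2} φ₁(j))`, and `24 ≤ 6 C`.
Markov's inequality yields the tail `8 exp (-x² / (2 B²))`, with `B` the scale allowed by the
theorem. Capped at `1`, this tail is below `2 √e exp (-x² / (4 B²))`, because the exponent is twice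
as large (`le_two_mul_sqrt_exp_one_mul`).
-/

namespace PhiMixing

/-! ### Scalar and pathwise inequalities -/

theorem hasSum_cosh_sqrt {u : ℝ} (hu : 0 ≤ u) :
    HasSum (fun k : ℕ => u ^ k / ((2 * k).factorial : ℝ)) (Real.cosh (√u)) := by
  simpa [pow_mul, Real.sq_sqrt hu] using Real.hasSum_cosh (√u)

theorem convexOn_cosh_sqrt : ConvexOn ℝ (Set.Ici 0) fun u : ℝ => Real.cosh (√u) := by
  refine ⟨convex_Ici 0, fun u hu v hv a b ha hb hab => ?_⟩
  simp only [Set.mem_Ici, smul_eq_mul] at *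
  refine hasSum_le (fun k => ?_) (hasSum_cosh_sqrt (by positivity))
    (((hasSum_cosh_sqrt hu).mul_left a).add ((hasSum_cosh_sqrt hv).mul_left b))
  have := (convexOn_pow (𝕜 := ℝ) k).2 hu hv ha hb hab
  simp only [smul_eq_mul] at this
  calc _ ≤ (a * u ^ k + b * v ^ k) / ((2 * k).factorial : ℝ) := by gcongr
    _ = _ := by ring

/-- The graph of `u ↦ cosh √u` lies below its chord between `(a - c) ^ 2` and `(a + c) ^ 2`. -/
theorem cosh_sqrt_secant {a c t : ℝ} (h1 : -1 ≤ t) (h2 : t ≤ 1) :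
    Real.cosh (√(a ^ 2 + c ^ 2 + 2 * a * c * t)) ≤
      Real.cosh a * Real.cosh c + t * (Real.sinh a * Real.sinh c) := by
  have := convexOn_cosh_sqrt.2 (Set.mem_Ici.2 (sq_nonneg (a + c)))
    (Set.mem_Ici.2 (sq_nonneg (a - c))) (show 0 ≤ (1 + t) / 2 by linarith)
    (show 0 ≤ (1 - t) / 2 by linarith) (by ring)
  simp only [smul_eq_mul, Real.sqrt_sq_eq_abs, Real.cosh_abs, Real.cosh_add, Real.cosh_sub] at this
  rw [show (1 + t) / 2 * (a + c) ^ 2 + (1 - t) / 2 * (a - c) ^ 2 =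
    a ^ 2 + c ^ 2 + 2 * a * c * t by ring] at this
  linarith

theorem div_mul_self_le_of_nonneg {a b : ℝ} (ha : 0 ≤ a) : a / b * b ≤ a := by
  rcases eq_or_ne b 0 with rfl | hb
  · simpa
  · rw [div_mul_cancel₀ _ hb]

section Hilbert
variable {H : Type*} [NormedAddCommGroup H] [InnerProductSpace ℝ H]

/-- Adding a vector `d` of norm at most `c` multiplies `cosh ‖x‖` by at most `cosh c`, up to a term
linear in `d`. The linear term has zero mean when `d` is a martingale increment. The vector paired
with `d` vanishes when `x = 0` or `c = 0`, and the bound holds there as well. -/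
theorem cosh_norm_add_le {x d : H} {c : ℝ} (hd : ‖d‖ ≤ c) :
    Real.cosh ‖x + d‖ ≤ Real.cosh c * Real.cosh ‖x‖ +
      inner ℝ ((Real.sinh c / c * (Real.sinh ‖x‖ / ‖x‖)) • x) d := by
  have hc : 0 ≤ c := (norm_nonneg d).trans hd
  rcases hc.eq_or_lt with rfl | hc
  · simp [norm_le_zero_iff.1 hd]
  rcases eq_or_ne x 0 with rfl | hx
  · simpa [abs_of_nonneg hc.le] using hd
  have hx' : 0 < ‖x‖ := norm_pos_iff.2 hx
  have hin : |inner ℝ x d| ≤ ‖x‖ * c :=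
    (abs_real_inner_le_norm x d).trans (by gcongr)
  rw [abs_le] at hin
  have key := cosh_sqrt_secant (a := ‖x‖) (c := c) (t := inner ℝ x d / (‖x‖ * c))
    (by rw [le_div_iff₀ (by positivity)]; linarith) (by rw [div_le_iff₀ (by positivity)]; linarith)
  have hle : Real.cosh ‖x + d‖ ≤
      Real.cosh (√(‖x‖ ^ 2 + c ^ 2 + 2 * ‖x‖ * c * (inner ℝ x d / (‖x‖ * c)))) := by
    rw [Real.cosh_le_cosh, abs_of_nonneg (norm_nonneg _), abs_of_nonneg (Real.sqrt_nonneg _)]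
    apply Real.le_sqrt_of_sq_le
    rw [norm_add_sq_real]
    have : 2 * ‖x‖ * c * (inner ℝ x d / (‖x‖ * c)) = 2 * inner ℝ x d := by field_simp
    have : ‖d‖ ^ 2 ≤ c ^ 2 := by gcongr
    linarith
  refine hle.trans (key.trans_eq ?_)
  rw [inner_smul_left]
  simp only [conj_trivial]
  field_simp

/-- The tangent-plane bound for the convex function `exp (‖·‖ / 2)`; at `x = 0` the subgradient used
is `0`. -/
theorem exp_half_norm_tangent (x d : H) :
    Real.exp (‖x‖ / 2) + inner ℝ ((Real.exp (‖x‖ / 2) / 2 / ‖x‖) • x) d ≤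
      Real.exp (‖x + d‖ / 2) := by
  rcases eq_or_ne x 0 with rfl | hx
  · have := norm_nonneg d
    simpa using (by positivity : 0 ≤ ‖d‖ / 2)
  have hx' : 0 < ‖x‖ := norm_pos_iff.2 hx
  have h1 : ‖x‖ + inner ℝ x d / ‖x‖ ≤ ‖x + d‖ := by
    have := real_inner_le_norm x (x + d)
    rw [inner_add_right, real_inner_self_eq_norm_sq] at this
    rw [← mul_le_mul_iff_right₀ hx']
    calc _ = ‖x‖ ^ 2 + inner ℝ x d := by field_simp
      _ ≤ _ := this
  have h2 := Real.add_one_le_exp (‖x + d‖ / 2 - ‖x‖ / 2)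
  calc _ = Real.exp (‖x‖ / 2) * (inner ℝ x d / ‖x‖ / 2 + 1) := by
        rw [inner_smul_left]; simp only [conj_trivial]; field_simp; ring
    _ ≤ Real.exp (‖x‖ / 2) * Real.exp (‖x + d‖ / 2 - ‖x‖ / 2) := by
        gcongr; linarith
    _ = _ := by rw [← Real.exp_add]; congr 1; ring

end Hilbert

/-- Summation by parts for the running maximum: it only moves at times when it equals the current
value of the sequence. -/
theorem sq_partialSups_add_sum_le (z : ℕ → ℝ) (n : ℕ) :
    partialSups z n ^ 2 / 2 +
      ∑ k ∈ Finset.range n, partialSups z k * (z (k + 1) - z k) ≤ partialSups z n * z n := by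
  induction n with
  | zero =>
    simp only [partialSups_zero, Finset.range_zero, Finset.sum_empty]
    nlinarith [sq_nonneg (z 0)]
  | succ n ih =>
    rw [Finset.sum_range_succ, partialSups_add_one]
    rcases le_total (partialSups z n) (z (n + 1)) with h | h
    · rw [sup_eq_right.2 h]; nlinarith
    · rw [sup_eq_left.2 h]; nlinarith

/-- A pathwise form of Doob's `L²` maximal inequality: for a submartingale the sum on the left has
nonnegative mean. -/
theorem sq_partialSups_le (z : ℕ → ℝ) (n : ℕ) :
    partialSups z n ^ 2 + 4 * ∑ k ∈ Finset.range n, partialSups z k * (z (k + 1) - z k) ≤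
      4 * z n ^ 2 := by
  nlinarith [sq_partialSups_add_sum_le z n, sq_nonneg (partialSups z n - 2 * z n)]

theorem exp_partialSups_le (r : ℕ → ℝ) (n : ℕ) :
    Real.exp (partialSups r n) ≤ partialSups (fun k => Real.exp (r k / 2)) n ^ 2 := by
  set m := partialSups (fun k => Real.exp (r k / 2)) n
  have hm : 0 < m := (Real.exp_pos _).trans_le
    (le_partialSups (fun k => Real.exp (r k / 2)) n)
  rw [← Real.le_log_iff_exp_le (by positivity), Real.log_pow]
  refine partialSups_le _ _ _ fun k hk => ?_
  have : r k / 2 ≤ Real.log m := by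
    rw [Real.le_log_iff_exp_le hm]
    exact le_partialSups_of_le (fun k => Real.exp (r k / 2)) hk
  push_cast; linarith

theorem stronglyMeasurable_partialSups {Ω : Type*} {m : MeasurableSpace Ω} {f : ℕ → Ω → ℝ} {n : ℕ}
    (hf : ∀ k ≤ n, StronglyMeasurable (f k)) :
    StronglyMeasurable fun ω => partialSups (fun k => f k ω) n := by
  induction n with
  | zero => simpa using hf 0 le_rfl
  | succ n ih =>
    simp only [partialSups_add_one]
    exact (ih fun k hk => hf k (hk.trans n.le_succ)).sup (hf _ le_rfl)

/-! ### Martingales with bounded increments -/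

section Martingale
variable {Ω H : Type*} [NormedAddCommGroup H] [InnerProductSpace ℝ H]
  {mΩ : MeasurableSpace Ω} {P : Measure Ω}

theorem integral_inner_eq_zero_of_condExp_eq_zero [CompleteSpace H] [IsFiniteMeasure P]
    {m : MeasurableSpace Ω} (hm : m ≤ mΩ)
    {f d : Ω → H} (hf : StronglyMeasurable[m] f) (hd : Integrable d P) (hd0 : P[d|m] =ᵐ[P] 0)
    {K : ℝ} (hK : ∀ᵐ ω ∂P, ‖f ω‖ ≤ K) : ∫ ω, inner ℝ (f ω) (d ω) ∂P = 0 := by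
  have h := condExp_stronglyMeasurable_bilin_of_bound (innerSL ℝ (E := H)) hm hf hd K hK
  rw [← integral_condExp hm]
  refine integral_eq_zero_of_ae (h.trans ?_)
  filter_upwards [hd0] with ω hω
  simp [hω]

theorem integrable_inner_of_bound {m : MeasurableSpace Ω} (hm : m ≤ mΩ)
    {f d : Ω → H} (hf : StronglyMeasurable[m] f) (hd : Integrable d P)
    {K : ℝ} (hK : ∀ᵐ ω ∂P, ‖f ω‖ ≤ K) : Integrable (fun ω => inner ℝ (f ω) (d ω)) P :=
  (innerSL ℝ (E := H)).integrable_of_bilin_of_bdd_left K (hf.mono hm).aestronglyMeasurable hK hd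

/-- `D` is a sequence of martingale differences for the filtration `G`, bounded almost surely by `c`.
The indices are shifted: `D k` is `G (k + 1)`-measurable with zero conditional expectation given
`G k`. -/
structure IsBddMartDiff (P : Measure Ω) (G : ℕ → MeasurableSpace Ω) (D : ℕ → Ω → H) (c : ℝ) :
    Prop where
  mono : Monotone G
  le : ∀ k, G k ≤ mΩ
  meas : ∀ k, StronglyMeasurable[G (k + 1)] (D k)
  condExp : ∀ k, P[D k|G k] =ᵐ[P] 0
  bound : ∀ k, ∀ᵐ ω ∂P, ‖D k ω‖ ≤ c

namespace IsBddMartDiff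
variable {G : ℕ → MeasurableSpace Ω} {D : ℕ → Ω → H} {c : ℝ}

theorem const_smul [CompleteSpace H] (h : IsBddMartDiff P G D c) {r : ℝ} (hr : 0 ≤ r) :
    IsBddMartDiff P G (fun k => r • D k) (r * c) where
  mono := h.mono
  le := h.le
  meas k := (h.meas k).const_smul r
  condExp k := by
    filter_upwards [condExp_smul (μ := P) r (D k) (G k), h.condExp k] with ω h1 h2
    rw [h1]; simp [h2]
  bound k := by
    filter_upwards [h.bound k] with ω hω
    simp only [Pi.smul_apply, norm_smul, Real.norm_eq_abs, abs_of_nonneg hr]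
    gcongr

theorem integrable [IsFiniteMeasure P] (h : IsBddMartDiff P G D c) (k : ℕ) : Integrable (D k) P :=
  Integrable.of_bound ((h.meas k).mono (h.le _)).aestronglyMeasurable c (h.bound k)

theorem sum_meas (h : IsBddMartDiff P G D c) (k : ℕ) :
    StronglyMeasurable[G k] fun ω => ∑ l ∈ Finset.range k, D l ω :=
  Finset.stronglyMeasurable_fun_sum _ fun l hl =>
    (h.meas l).mono (h.mono (Finset.mem_range.1 hl))

theorem sum_bound (h : IsBddMartDiff P G D c) (k : ℕ) :
    ∀ᵐ ω ∂P, ‖∑ l ∈ Finset.range k, D l ω‖ ≤ k * c := by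
  filter_upwards [ae_all_iff.2 h.bound] with ω hω
  simpa using norm_sum_le_of_le (Finset.range k) fun l _ => hω l

theorem integrable_comp_norm [IsFiniteMeasure P] (h : IsBddMartDiff P G D c) (k : ℕ) {g : ℝ → ℝ}
    (hg : Continuous g) :
    Integrable (fun ω => g ‖∑ l ∈ Finset.range k, D l ω‖) P := by
  obtain ⟨K, hK⟩ := (isCompact_Icc (a := (0 : ℝ)) (b := k * c)).exists_bound_of_continuousOn
    hg.continuousOn
  refine Integrable.of_bound (hg.comp_stronglyMeasurable
    ((h.sum_meas k).mono (h.le k)).norm).aestronglyMeasurable K ?_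
  filter_upwards [h.sum_bound k] with ω hω
  exact hK _ ⟨norm_nonneg _, hω⟩

theorem integral_cosh_succ_le [CompleteSpace H] [IsFiniteMeasure P]
    (h : IsBddMartDiff P G D c) (k : ℕ) :
    ∫ ω, Real.cosh ‖∑ l ∈ Finset.range (k + 1), D l ω‖ ∂P ≤
      Real.cosh c * ∫ ω, Real.cosh ‖∑ l ∈ Finset.range k, D l ω‖ ∂P := by
  set M : Ω → H := fun ω => ∑ l ∈ Finset.range k, D l ω with hM
  have hMm : StronglyMeasurable[G k] M := h.sum_meas k
  set f : Ω → H := fun ω => (Real.sinh c / c * (Real.sinh ‖M ω‖ / ‖M ω‖)) • M ω with hf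
  have hfm : StronglyMeasurable[G k] f := by
    refine StronglyMeasurable.smul (Measurable.stronglyMeasurable ?_) hMm
    have := hMm.norm.measurable
    exact (((Real.measurable_sinh.comp this).div this).const_mul _)
  have hfb : ∀ᵐ ω ∂P, ‖f ω‖ ≤ |Real.sinh c / c| * Real.sinh (k * c) := by
    filter_upwards [h.sum_bound k] with ω hω
    have h0 : |Real.sinh ‖M ω‖ / ‖M ω‖| * ‖M ω‖ ≤ Real.sinh ‖M ω‖ := by
      have : 0 ≤ Real.sinh ‖M ω‖ := Real.sinh_nonneg_iff.2 (norm_nonneg _)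
      rw [abs_of_nonneg (by positivity)]
      exact div_mul_self_le_of_nonneg this
    calc ‖f ω‖ = |Real.sinh c / c| * (|Real.sinh ‖M ω‖ / ‖M ω‖| * ‖M ω‖) := by
          rw [hf, norm_smul, Real.norm_eq_abs, abs_mul, mul_assoc]
      _ ≤ _ := by
          gcongr
          exact h0.trans (Real.sinh_le_sinh.2 hω)
  have h0 := integral_inner_eq_zero_of_condExp_eq_zero (h.le k) hfm (h.integrable k)
    (h.condExp k) hfb
  have hi := integrable_inner_of_bound (h.le k) hfm (h.integrable k) hfb
  have hc := h.integrable_comp_norm k Real.continuous_cosh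
  calc _ ≤ ∫ ω, (Real.cosh c * Real.cosh ‖M ω‖ + inner ℝ (f ω) (D k ω)) ∂P := by
        refine integral_mono_ae (h.integrable_comp_norm (k + 1) Real.continuous_cosh)
          ((hc.const_mul _).add hi) ?_
        filter_upwards [h.bound k] with ω hω
        simp only [Finset.sum_range_succ]
        exact cosh_norm_add_le hω
    _ = _ := by
        rw [integral_add (hc.const_mul _) hi, h0, add_zero, integral_const_mul]

/-- Pinelis' bound: `E cosh ‖M_n‖ ≤ exp (n c² / 2)` for the martingale `M` with increments `D`. -/
theorem integral_cosh_le [CompleteSpace H] [IsProbabilityMeasure P]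
    (h : IsBddMartDiff P G D c) (n : ℕ) :
    ∫ ω, Real.cosh ‖∑ l ∈ Finset.range n, D l ω‖ ∂P ≤ Real.exp (n * (c ^ 2 / 2)) := by
  induction n with
  | zero => simp
  | succ n ih =>
    calc _ ≤ _ := h.integral_cosh_succ_le n
      _ ≤ Real.exp (c ^ 2 / 2) * Real.exp (n * (c ^ 2 / 2)) := by
          gcongr
          exact Real.cosh_le_exp_half_sq c
      _ = _ := by rw [← Real.exp_add]; congr 1; push_cast; ring

/-- `exp (‖M_k‖ / 2)` is a submartingale, tested against a nonnegative `G k`-measurable weight. -/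
theorem integral_max_mul_increment_nonneg [CompleteSpace H] [IsFiniteMeasure P]
    (h : IsBddMartDiff P G D c) {m : Ω → ℝ} {k : ℕ}
    (hm : StronglyMeasurable[G k] m) (hm0 : ∀ ω, 0 ≤ m ω) {K : ℝ} (hK : ∀ᵐ ω ∂P, m ω ≤ K) :
    0 ≤ ∫ ω, m ω * (Real.exp (‖∑ l ∈ Finset.range (k + 1), D l ω‖ / 2) -
      Real.exp (‖∑ l ∈ Finset.range k, D l ω‖ / 2)) ∂P := by
  set M : Ω → H := fun ω => ∑ l ∈ Finset.range k, D l ω with hM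
  have hMm : StronglyMeasurable[G k] M := h.sum_meas k
  set f : Ω → H := fun ω => (m ω * (Real.exp (‖M ω‖ / 2) / 2 / ‖M ω‖)) • M ω with hf
  have hfm : StronglyMeasurable[G k] f := by
    refine StronglyMeasurable.smul (Measurable.stronglyMeasurable ?_) hMm
    have := hMm.norm.measurable
    exact hm.measurable.mul (((Real.measurable_exp.comp (this.div_const 2)).div_const 2).div this)
  have hfb : ∀ᵐ ω ∂P, ‖f ω‖ ≤ K * (Real.exp (k * c / 2) / 2) := by
    filter_upwards [h.sum_bound k, hK] with ω hω hKω
    have h0 : Real.exp (‖M ω‖ / 2) / 2 / ‖M ω‖ * ‖M ω‖ ≤ Real.exp (‖M ω‖ / 2) / 2 :=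
      div_mul_self_le_of_nonneg (by positivity)
    have h1 : 0 ≤ m ω * (Real.exp (‖M ω‖ / 2) / 2 / ‖M ω‖) := mul_nonneg (hm0 ω) (by positivity)
    calc ‖f ω‖ = m ω * (Real.exp (‖M ω‖ / 2) / 2 / ‖M ω‖ * ‖M ω‖) := by
          rw [hf, norm_smul, Real.norm_eq_abs, abs_of_nonneg h1, mul_assoc]
      _ ≤ _ := by
          have h2 : Real.exp (‖M ω‖ / 2) / 2 ≤ Real.exp (k * c / 2) / 2 := by gcongr
          exact mul_le_mul hKω (h0.trans h2) (by positivity) ((hm0 ω).trans hKω)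
  have h0 := integral_inner_eq_zero_of_condExp_eq_zero (h.le k) hfm (h.integrable k)
    (h.condExp k) hfb
  have hexp : Continuous fun t : ℝ => Real.exp (t / 2) := by fun_prop
  rw [← h0]
  refine integral_mono_ae (integrable_inner_of_bound (h.le k) hfm (h.integrable k) hfb)
    (((h.integrable_comp_norm (k + 1) hexp).sub (h.integrable_comp_norm k hexp)).bdd_mul
      (hm.mono (h.le k)).aestronglyMeasurable (c := K) ?_) ?_
  · filter_upwards [hK] with ω hω
    rwa [Real.norm_eq_abs, abs_of_nonneg (hm0 ω)]
  · refine Filter.Eventually.of_forall fun ω => ?_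
    have := mul_le_mul_of_nonneg_left (exp_half_norm_tangent (M ω) (D k ω)) (hm0 ω)
    simp only [Finset.sum_range_succ, hf]
    rw [mul_smul, inner_smul_left]
    simp only [conj_trivial]
    simp only [hM] at this ⊢
    linarith

/-- Doob's `L²` inequality for `exp (‖M_k‖ / 2)` costs a factor `4`, and `exp ≤ 2 cosh` a factor
`2`. -/
theorem integral_exp_partialSups_le [CompleteSpace H] [IsProbabilityMeasure P]
    (h : IsBddMartDiff P G D c) (n : ℕ) :
    ∫⁻ ω, ENNReal.ofReal (Real.exp (partialSups
      (fun k => ‖∑ l ∈ Finset.range k, D l ω‖) n)) ∂P ≤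
      ENNReal.ofReal (8 * Real.exp (n * (c ^ 2 / 2))) := by
  have hexp : Continuous fun t : ℝ => Real.exp (t / 2) := by fun_prop
  set z : Ω → ℕ → ℝ := fun ω k => Real.exp (‖∑ l ∈ Finset.range k, D l ω‖ / 2) with hz
  have hzm (k : ℕ) : StronglyMeasurable[G k] fun ω => z ω k :=
    hexp.comp_stronglyMeasurable (h.sum_meas k).norm
  have hmm (k : ℕ) : StronglyMeasurable[G k] fun ω => partialSups (z ω) k :=
    stronglyMeasurable_partialSups fun i hi => (hzm i).mono (h.mono hi)
  have hz0 (ω : Ω) (k : ℕ) : 0 ≤ z ω k := (Real.exp_pos _).le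
  have hm0 (ω : Ω) (k : ℕ) : 0 ≤ partialSups (z ω) k := (hz0 ω k).trans (le_partialSups _ _)
  obtain ⟨ω₀, hω₀⟩ := (h.bound 0).exists
  have hc : 0 ≤ c := (norm_nonneg _).trans hω₀
  have hmb (k : ℕ) : ∀ᵐ ω ∂P, partialSups (z ω) k ≤ Real.exp (k * c / 2) := by
    filter_upwards [ae_all_iff.2 h.sum_bound] with ω hω
    refine partialSups_le _ _ _ fun i hi => Real.exp_le_exp.2 ?_
    have := hω i
    have : (i : ℝ) * c ≤ k * c := by gcongr
    linarith
  have hmi (k : ℕ) : Integrable (fun ω => partialSups (z ω) k ^ 2) P := by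
    refine Integrable.of_bound (((hmm k).mono (h.le k)).pow 2).aestronglyMeasurable
      (Real.exp (k * c / 2) ^ 2) ?_
    filter_upwards [hmb k] with ω hω
    rw [norm_pow, Real.norm_eq_abs, abs_of_nonneg (hm0 ω k)]
    exact pow_le_pow_left₀ (hm0 ω k) hω 2
  have hinc (k : ℕ) : Integrable (fun ω => partialSups (z ω) k * (z ω (k + 1) - z ω k)) P := by
    refine ((h.integrable_comp_norm (k + 1) hexp).sub (h.integrable_comp_norm k hexp)).bdd_mul
      ((hmm k).mono (h.le k)).aestronglyMeasurable (c := Real.exp (k * c / 2)) ?_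
    filter_upwards [hmb k] with ω hω
    rwa [Real.norm_eq_abs, abs_of_nonneg (hm0 ω k)]
  have hsum : 0 ≤ ∫ ω, ∑ k ∈ Finset.range n, partialSups (z ω) k * (z ω (k + 1) - z ω k) ∂P := by
    rw [integral_finsetSum _ fun k _ => hinc k]
    exact Finset.sum_nonneg fun k _ =>
      h.integral_max_mul_increment_nonneg (hmm k) (fun ω => hm0 ω k) (hmb k)
  have hcosh := h.integrable_comp_norm n Real.continuous_cosh
  have hs : Integrable (fun ω => ∑ k ∈ Finset.range n,
      partialSups (z ω) k * (z ω (k + 1) - z ω k)) P := integrable_finsetSum _ fun k _ => hinc k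
  have key : ∫ ω, partialSups (z ω) n ^ 2 ∂P ≤ 8 * Real.exp (n * (c ^ 2 / 2)) := by
    calc ∫ ω, partialSups (z ω) n ^ 2 ∂P
        ≤ ∫ ω, (8 * Real.cosh ‖∑ l ∈ Finset.range n, D l ω‖ - 4 * ∑ k ∈ Finset.range n,
            partialSups (z ω) k * (z ω (k + 1) - z ω k)) ∂P := by
          refine integral_mono (hmi n) ((hcosh.const_mul 8).sub (hs.const_mul 4)) fun ω => ?_
          have h1 := sq_partialSups_le (z ω) n
          have h2 : z ω n ^ 2 ≤ 2 * Real.cosh ‖∑ l ∈ Finset.range n, D l ω‖ := by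
            rw [Real.cosh_eq, hz, ← Real.exp_nat_mul]
            have := Real.exp_pos (-‖∑ l ∈ Finset.range n, D l ω‖)
            have : Real.exp ((2 : ℕ) * (‖∑ l ∈ Finset.range n, D l ω‖ / 2)) =
              Real.exp ‖∑ l ∈ Finset.range n, D l ω‖ := by congr 1; push_cast; ring
            linarith
          dsimp only
          linarith
      _ ≤ 8 * Real.exp (n * (c ^ 2 / 2)) := by
          rw [integral_sub (hcosh.const_mul 8) (hs.const_mul 4), integral_const_mul,
            integral_const_mul]
          have := h.integral_cosh_le n
          linarith
  calc _ ≤ ∫⁻ ω, ENNReal.ofReal (partialSups (z ω) n ^ 2) ∂P :=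
        lintegral_mono fun ω => ENNReal.ofReal_le_ofReal (exp_partialSups_le _ n)
    _ = ENNReal.ofReal (∫ ω, partialSups (z ω) n ^ 2 ∂P) :=
        (ofReal_integral_eq_lintegral_ofReal (hmi n) (ae_of_all _ fun ω => sq_nonneg _)).symm
    _ ≤ _ := ENNReal.ofReal_le_ofReal key

end IsBddMartDiff
end Martingale

/-! ### Sums of variables with Gaussian exponential moments -/

section ExpSq
variable {Ω : Type*} {mΩ : MeasurableSpace Ω} {P : Measure Ω} {U V : Ω → ℝ} {σ τ : ℝ}

/-- The exponential moments of `U` are at most `8` times those of a centred Gaussian of scale `σ`: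
`E exp (t U) ≤ 8 exp (t² τ² / 2)` for all `t ≥ 0` and `τ > σ`. Quantifying over `τ > σ` instead of
taking `τ = σ` makes the case `σ = 0` uniform with the others in `ExpSqBound.add`. -/
def ExpSqBound (P : Measure Ω) (U : Ω → ℝ) (σ : ℝ) : Prop :=
  ∀ τ, σ < τ → ∀ t, 0 ≤ t →
    ∫⁻ ω, ENNReal.ofReal (Real.exp (t * U ω)) ∂P ≤ ENNReal.ofReal (8 * Real.exp (t ^ 2 * τ ^ 2 / 2))

namespace ExpSqBound

theorem mono (h : ExpSqBound P V τ) (hUV : ∀ᵐ ω ∂P, U ω ≤ V ω) (hτ : τ ≤ σ) :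
    ExpSqBound P U σ := fun ρ hρ t ht => by
  refine (lintegral_mono_ae ?_).trans (h ρ (hτ.trans_lt hρ) t ht)
  filter_upwards [hUV] with ω hω
  gcongr

theorem const [IsProbabilityMeasure P] (a : ℝ) : ExpSqBound P (fun _ => a) a := by
  intro τ hτ t ht
  simp only [lintegral_const, measure_univ, mul_one]
  refine ENNReal.ofReal_le_ofReal ?_
  have h1 : t * a ≤ 1 + t ^ 2 * τ ^ 2 / 2 := by
    have : t * a ≤ t * τ := by gcongr
    nlinarith [sq_nonneg (t * τ - 1)]
  calc Real.exp (t * a) ≤ Real.exp (1 + t ^ 2 * τ ^ 2 / 2) := Real.exp_le_exp.2 h1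
    _ = Real.exp 1 * Real.exp (t ^ 2 * τ ^ 2 / 2) := Real.exp_add _ _
    _ ≤ _ := by gcongr; linarith [Real.exp_one_lt_d9]

/-- Scales add, without any independence: `U + V` is a convex combination of `U` and `V`, each
rescaled by its share of the total scale, and `exp` is convex. -/
theorem add (hU : ExpSqBound P U σ) (hV : ExpSqBound P V τ) (hσ : 0 ≤ σ) (hτ : 0 ≤ τ)
    (hUm : Measurable U) : ExpSqBound P (fun ω => U ω + V ω) (σ + τ) := by
  intro ρ hρ t ht
  -- The slack `ρ - (σ + τ)` is shared equally, so that both scales become positive.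
  set a := σ + (ρ - (σ + τ)) / 2 with ha
  set b := τ + (ρ - (σ + τ)) / 2 with hb
  have hab : a + b = ρ := by rw [ha, hb]; ring
  have ha0 : 0 < a := by rw [ha]; linarith
  have hb0 : 0 < b := by rw [hb]; linarith
  have hρ0 : 0 < ρ := by linarith
  have h1 := hU a (by rw [ha]; linarith) (t * ρ / a) (by positivity)
  have h2 := hV b (by rw [hb]; linarith) (t * ρ / b) (by positivity)
  have e1 : (t * ρ / a) ^ 2 * a ^ 2 / 2 = t ^ 2 * ρ ^ 2 / 2 := by field_simp
  have e2 : (t * ρ / b) ^ 2 * b ^ 2 / 2 = t ^ 2 * ρ ^ 2 / 2 := by field_simp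
  rw [e1] at h1
  rw [e2] at h2
  have hp (ω : Ω) : ENNReal.ofReal (Real.exp (t * (U ω + V ω))) ≤
      ENNReal.ofReal (a / ρ) * ENNReal.ofReal (Real.exp (t * ρ / a * U ω)) +
      ENNReal.ofReal (b / ρ) * ENNReal.ofReal (Real.exp (t * ρ / b * V ω)) := by
    rw [← ENNReal.ofReal_mul (by positivity), ← ENNReal.ofReal_mul (by positivity),
      ← ENNReal.ofReal_add (by positivity) (by positivity)]
    refine ENNReal.ofReal_le_ofReal ?_
    have := convexOn_exp.2 (Set.mem_univ (t * ρ / a * U ω)) (Set.mem_univ (t * ρ / b * V ω))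
      (show 0 ≤ a / ρ by positivity) (show 0 ≤ b / ρ by positivity)
      (by rw [← add_div, hab, div_self hρ0.ne'])
    simp only [smul_eq_mul] at this
    rwa [show a / ρ * (t * ρ / a * U ω) + b / ρ * (t * ρ / b * V ω) = t * (U ω + V ω) by
      field_simp] at this
  calc _ ≤ ∫⁻ ω, (ENNReal.ofReal (a / ρ) * ENNReal.ofReal (Real.exp (t * ρ / a * U ω)) +
      ENNReal.ofReal (b / ρ) * ENNReal.ofReal (Real.exp (t * ρ / b * V ω))) ∂P := lintegral_mono hp
    _ = ENNReal.ofReal (a / ρ) * ∫⁻ ω, ENNReal.ofReal (Real.exp (t * ρ / a * U ω)) ∂P +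
      ENNReal.ofReal (b / ρ) * ∫⁻ ω, ENNReal.ofReal (Real.exp (t * ρ / b * V ω)) ∂P := by
        rw [lintegral_add_left (by fun_prop), lintegral_const_mul' _ _ ENNReal.ofReal_ne_top,
          lintegral_const_mul' _ _ ENNReal.ofReal_ne_top]
    _ ≤ ENNReal.ofReal (a / ρ) * ENNReal.ofReal (8 * Real.exp (t ^ 2 * ρ ^ 2 / 2)) +
      ENNReal.ofReal (b / ρ) * ENNReal.ofReal (8 * Real.exp (t ^ 2 * ρ ^ 2 / 2)) := by gcongr
    _ = _ := by
        rw [← add_mul, ← ENNReal.ofReal_add (by positivity) (by positivity), ← add_div, hab,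
          div_self hρ0.ne', ENNReal.ofReal_one, one_mul]

theorem measure_ge_le_of_lt (hU : ExpSqBound P U σ) (hστ : σ < τ) (hτ : 0 < τ)
    (hUm : Measurable U) {x : ℝ}
    (hx : 0 ≤ x) :
    P {ω | x ≤ U ω} ≤ ENNReal.ofReal (8 * Real.exp (-(x ^ 2 / (2 * τ ^ 2)))) := by
  -- `t = x / τ ^ 2` minimizes `-t x + t ^ 2 τ ^ 2 / 2`.
  have h := hU τ hστ (x / τ ^ 2) (by positivity)
  have hsub : P {ω | x ≤ U ω} ≤ P {ω | ENNReal.ofReal (Real.exp (x / τ ^ 2 * x)) ≤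
      ENNReal.ofReal (Real.exp (x / τ ^ 2 * U ω))} := by
    refine measure_mono fun ω (hω : x ≤ U ω) => ENNReal.ofReal_le_ofReal ?_
    gcongr
  have hpos : 0 < Real.exp (x / τ ^ 2 * x) := Real.exp_pos _
  refine hsub.trans ((meas_ge_le_lintegral_div (by fun_prop) (by simpa using hpos)
    ENNReal.ofReal_ne_top).trans ((ENNReal.div_le_div_right h _).trans_eq ?_))
  rw [← ENNReal.ofReal_div_of_pos hpos, mul_div_assoc, ← Real.exp_sub]
  congr 3
  field_simp
  ring

theorem measure_ge_le (hU : ExpSqBound P U σ) (hσ : 0 < σ) (hUm : Measurable U) {x : ℝ}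
    (hx : 0 ≤ x) :
    P {ω | x ≤ U ω} ≤ ENNReal.ofReal (8 * Real.exp (-(x ^ 2 / (2 * σ ^ 2)))) := by
  have hc : ContinuousAt
      (fun τ : ℝ => ENNReal.ofReal (8 * Real.exp (-(x ^ 2 / (2 * τ ^ 2))))) σ := by
    refine ENNReal.continuous_ofReal.continuousAt.comp ?_
    fun_prop (disch := positivity)
  refine ge_of_tendsto (hc.tendsto.mono_left (nhdsWithin_le_nhds (s := Set.Ioi σ))) ?_
  filter_upwards [self_mem_nhdsWithin] with τ hτ
  exact hU.measure_ge_le_of_lt hτ (hσ.trans hτ) hUm hx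

end ExpSqBound
end ExpSq

/-- The maximal Azuma–Hoeffding inequality in Hilbert space, in terms of exponential moments. -/
theorem IsBddMartDiff.expSqBound {Ω H : Type*} [NormedAddCommGroup H] [InnerProductSpace ℝ H]
    [CompleteSpace H] {mΩ : MeasurableSpace Ω} {P : Measure Ω} [IsProbabilityMeasure P]
    {G : ℕ → MeasurableSpace Ω} {D : ℕ → Ω → H} {c : ℝ} (h : IsBddMartDiff P G D c) (n : ℕ) :
    ExpSqBound P (fun ω => partialSups (fun k => ‖∑ l ∈ Finset.range k, D l ω‖) n) (√n * c) := by
  intro τ hτ t ht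
  obtain ⟨ω₀, hω₀⟩ := (h.bound 0).exists
  have hc : 0 ≤ c := (norm_nonneg _).trans hω₀
  refine (lintegral_mono fun ω => ENNReal.ofReal_le_ofReal (Real.exp_le_exp.2 ?_)).trans
    (((h.const_smul ht).integral_exp_partialSups_le n).trans
      (ENNReal.ofReal_le_ofReal ?_))
  · rcases ht.eq_or_lt with rfl | ht
    · simpa using (norm_nonneg _).trans (le_partialSups
        (fun k => ‖∑ l ∈ Finset.range k, (0 : H)‖) n)
    rw [← le_div_iff₀' ht]
    refine partialSups_le _ _ _ fun k hk => ?_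
    rw [le_div_iff₀' ht]
    refine le_trans (le_of_eq ?_) (le_partialSups_of_le _ hk)
    simp [← Finset.smul_sum, norm_smul, abs_of_pos ht]
  · have : (√n * c) ^ 2 ≤ τ ^ 2 := by gcongr
    rw [mul_pow, Real.sq_sqrt (by positivity)] at this
    gcongr
    nlinarith [sq_nonneg t]

/-! ### Pairing consecutive terms -/

section Pairing
variable {Ω H : Type*} [NormedAddCommGroup H]

theorem sum_range_two_mul_eq {z d w : ℕ → H} (h : ∀ l, z (2 * l) + z (2 * l + 1) = d l + w l)
    (q : ℕ) : ∑ l ∈ Finset.range (2 * q), z l =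
      ∑ l ∈ Finset.range q, d l + ∑ l ∈ Finset.range q, w l := by
  induction q with
  | zero => simp
  | succ q ih =>
    rw [mul_add, mul_one, Finset.sum_range_succ, Finset.sum_range_succ, ih, add_assoc, h,
      Finset.sum_range_succ, Finset.sum_range_succ]
    abel

/-- If consecutive pairs of `z` are split as `d + w`, the partial sums of `z` are controlled by those
of `d` and `w` over half the range; an odd number of terms leaves one unpaired `z`, of norm at most
`a`. -/
theorem partialSups_norm_sum_le_of_pairs {z d w : ℕ → H} {a : ℝ}
    (h : ∀ l, z (2 * l) + z (2 * l + 1) = d l + w l) (ha : ∀ l, ‖z l‖ ≤ a) (m : ℕ) :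
    partialSups (fun k => ‖∑ l ∈ Finset.range k, z l‖) m ≤
      a + (partialSups (fun k => ‖∑ l ∈ Finset.range k, d l‖) (m / 2) +
        partialSups (fun k => ‖∑ l ∈ Finset.range k, w l‖) (m / 2)) := by
  have ha0 : 0 ≤ a := (norm_nonneg _).trans (ha 0)
  refine partialSups_le _ _ _ fun k hk => ?_
  obtain ⟨q, hq⟩ := Nat.even_or_odd' k
  have hqm : q ≤ m / 2 := by omega
  have hd := le_partialSups_of_le (fun k => ‖∑ l ∈ Finset.range k, d l‖) hqm
  have hw := le_partialSups_of_le (fun k => ‖∑ l ∈ Finset.range k, w l‖) hqm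
  have he : ‖∑ l ∈ Finset.range (2 * q), z l‖ ≤
      ‖∑ l ∈ Finset.range q, d l‖ + ‖∑ l ∈ Finset.range q, w l‖ := by
    rw [sum_range_two_mul_eq h]
    exact norm_add_le _ _
  rcases hq with rfl | rfl
  · linarith
  · rw [Finset.sum_range_succ]
    have := norm_add_le (∑ l ∈ Finset.range (2 * q), z l) (z (2 * q))
    linarith [ha (2 * q)]

theorem partialSups_norm_sum_add_le (d w : ℕ → H) (m : ℕ) :
    partialSups (fun k => ‖∑ l ∈ Finset.range k, (d l + w l)‖) m ≤
      partialSups (fun k => ‖∑ l ∈ Finset.range k, d l‖) m +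
        partialSups (fun k => ‖∑ l ∈ Finset.range k, w l‖) m := by
  refine partialSups_le _ _ _ fun k hk => ?_
  rw [Finset.sum_add_distrib]
  exact (norm_add_le _ _).trans (add_le_add
    (le_partialSups_of_le (fun k => ‖∑ l ∈ Finset.range k, d l‖) hk)
    (le_partialSups_of_le (fun k => ‖∑ l ∈ Finset.range k, w l‖) hk))

theorem measurable_partialSups_norm_sum {mΩ : MeasurableSpace Ω} {D : ℕ → Ω → H}
    (hD : ∀ k, StronglyMeasurable (D k))
    (n : ℕ) : Measurable fun ω => partialSups (fun k => ‖∑ l ∈ Finset.range k, D l ω‖) n :=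
  (stronglyMeasurable_partialSups fun _ _ =>
    (Finset.stronglyMeasurable_fun_sum _ fun l _ => hD l).norm).measurable

/-- The sum of `X` over the `l`-th dyadic block `(l 2^j, (l + 1) 2^j]` of level `j`. -/
def blockSum (X : ℕ → Ω → H) (j l : ℕ) : Ω → H :=
  ∑ k ∈ Finset.range (2 ^ j), X (l * 2 ^ j + k + 1)

theorem blockSum_succ (X : ℕ → Ω → H) (j l : ℕ) :
    blockSum X (j + 1) l = blockSum X j (2 * l) + blockSum X j (2 * l + 1) := by
  unfold blockSum
  rw [pow_succ, mul_two, Finset.sum_range_add]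
  congr 1
  · exact Finset.sum_congr rfl fun k _ => by congr 1; ring
  · exact Finset.sum_congr rfl fun k _ => by congr 1; ring

end Pairing

/-! ### The dyadic martingale decomposition -/

section Dyadic
variable {Ω H : Type*} [NormedAddCommGroup H] [InnerProductSpace ℝ H]
  {mΩ : MeasurableSpace Ω} {P : Measure Ω}

theorem isBddMartDiff_sub_condExp [CompleteSpace H] [IsFiniteMeasure P]
    {G : ℕ → MeasurableSpace Ω} {Y : ℕ → Ω → H} {b b' : ℝ} (hmono : Monotone G) (hle : ∀ k, G k ≤ mΩ)
    (hY : ∀ k, StronglyMeasurable[G (k + 1)] (Y k)) (hb : ∀ k, ∀ᵐ ω ∂P, ‖Y k ω‖ ≤ b)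
    (hb' : ∀ k, ∀ᵐ ω ∂P, ‖(P[Y k|G k]) ω‖ ≤ b') :
    IsBddMartDiff P G (fun k => Y k - P[Y k|G k]) (b + b') where
  mono := hmono
  le := hle
  meas k := (hY k).sub (stronglyMeasurable_condExp.mono (hmono k.le_succ))
  condExp k := by
    have hi : Integrable (Y k) P :=
      Integrable.of_bound ((hY k).mono (hle _)).aestronglyMeasurable b (hb k)
    refine (condExp_sub hi integrable_condExp (G k)).trans ?_
    rw [condExp_of_stronglyMeasurable (hle k) stronglyMeasurable_condExp integrable_condExp,
      sub_self]
  bound k := by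
    filter_upwards [hb k, hb' k] with ω h1 h2
    exact (norm_sub_le _ _).trans (add_le_add h1 h2)

/-- `X` is adapted to the filtration `F`, bounded almost surely by `M`, and its prediction `k + 1`
steps ahead, `E(X_{m+k+1} | F_m)`, is bounded almost surely by `θ k`, uniformly in `m`. -/
structure IsCondBdd (P : Measure Ω) (F : ℕ → MeasurableSpace Ω) (X : ℕ → Ω → H) (M : ℝ)
    (θ : ℕ → ℝ) : Prop where
  mono : Monotone F
  le : ∀ k, F k ≤ mΩ
  meas : ∀ k, StronglyMeasurable[F k] (X k)
  bound : ∀ k, ∀ᵐ ω ∂P, ‖X k ω‖ ≤ M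
  condExp_bound : ∀ m k, ∀ᵐ ω ∂P, ‖(P[X (m + k + 1)|F m]) ω‖ ≤ θ k

/-- The conditional expectation of the `l`-th block sum of level `j` given the past at the left
endpoint of the block. -/
noncomputable def blockProj (P : Measure Ω) (F : ℕ → MeasurableSpace Ω) (X : ℕ → Ω → H)
    (j l : ℕ) : Ω → H :=
  P[blockSum X j l|F (l * 2 ^ j)]

namespace IsCondBdd
variable {F : ℕ → MeasurableSpace Ω} {X : ℕ → Ω → H} {M : ℝ} {θ : ℕ → ℝ}

theorem integrable [IsFiniteMeasure P] (h : IsCondBdd P F X M θ) (k : ℕ) : Integrable (X k) P :=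
  Integrable.of_bound ((h.meas k).mono (h.le _)).aestronglyMeasurable M (h.bound k)

theorem integrable_blockSum [IsFiniteMeasure P] (h : IsCondBdd P F X M θ) (j l : ℕ) :
    Integrable (blockSum X j l) P :=
  integrable_finsetSum' _ fun _ _ => h.integrable _

theorem nonneg [IsProbabilityMeasure P] (h : IsCondBdd P F X M θ) (k : ℕ) : 0 ≤ θ k :=
  let ⟨_, hω⟩ := (h.condExp_bound 0 k).exists
  (norm_nonneg _).trans hω

theorem norm_condExp_sum_le [CompleteSpace H] [IsFiniteMeasure P] (h : IsCondBdd P F X M θ)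
    (m q r : ℕ) :
    ∀ᵐ ω ∂P, ‖(P[∑ k ∈ Finset.range r, X (m + q + k + 1)|F m]) ω‖ ≤
      ∑ k ∈ Finset.range r, θ (q + k) := by
  have h1 := condExp_finsetSum (μ := P) (s := Finset.range r) (f := fun k => X (m + q + k + 1))
    (fun _ _ => h.integrable _) (F m)
  have h2 : ∀ k, ∀ᵐ ω ∂P, ‖(P[X (m + q + k + 1)|F m]) ω‖ ≤ θ (q + k) := fun k => by
    simpa only [add_assoc] using h.condExp_bound m (q + k)
  filter_upwards [h1, ae_all_iff.2 h2] with ω hω hω2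
  rw [hω, Finset.sum_apply]
  exact norm_sum_le_of_le _ fun k _ => hω2 k

theorem norm_blockProj_le [CompleteSpace H] [IsFiniteMeasure P] (h : IsCondBdd P F X M θ)
    (j l : ℕ) : ∀ᵐ ω ∂P, ‖blockProj P F X j l ω‖ ≤ ∑ k ∈ Finset.range (2 ^ j), θ k := by
  simpa [blockProj, blockSum] using h.norm_condExp_sum_le (l * 2 ^ j) 0 (2 ^ j)

theorem condExp_blockProj [CompleteSpace H] [IsFiniteMeasure P] (h : IsCondBdd P F X M θ)
    (j l : ℕ) : P[blockProj P F X j (2 * l + 1)|F (l * 2 ^ (j + 1))] =ᵐ[P]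
      P[blockSum X j (2 * l + 1)|F (l * 2 ^ (j + 1))] :=
  condExp_condExp_of_le (h.mono (by rw [pow_succ]; nlinarith [Nat.zero_le (2 ^ j)])) (h.le _)

/-- The increments lost when two adjacent blocks of level `j` are merged: what the middle of the
merged block knows about its right half, minus what its left endpoint knows about it. Both terms are
predictions, and together their bounds run over `θ k` for `k < 2 ^ (j + 1)`. -/
theorem isBddMartDiff_block [CompleteSpace H] [IsFiniteMeasure P] (h : IsCondBdd P F X M θ)
    (j : ℕ) : IsBddMartDiff P (fun l => F (l * 2 ^ (j + 1)))
      (fun l => blockProj P F X j (2 * l + 1) -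
        P[blockProj P F X j (2 * l + 1)|F (l * 2 ^ (j + 1))])
      (∑ k ∈ Finset.range (2 ^ (j + 1)), θ k) := by
  rw [show ∑ k ∈ Finset.range (2 ^ (j + 1)), θ k = ∑ k ∈ Finset.range (2 ^ j), θ k +
    ∑ k ∈ Finset.range (2 ^ j), θ (2 ^ j + k) by rw [pow_succ, mul_two, Finset.sum_range_add]]
  refine isBddMartDiff_sub_condExp (fun a b hab => h.mono (by gcongr)) (fun _ => h.le _)
    (fun l => stronglyMeasurable_condExp.mono (h.mono ?_)) (fun l => h.norm_blockProj_le _ _)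
    fun l => ?_
  · rw [pow_succ]; nlinarith [Nat.zero_le (2 ^ j)]
  · filter_upwards [h.condExp_blockProj j l,
      h.norm_condExp_sum_le (l * 2 ^ (j + 1)) (2 ^ j) (2 ^ j)] with ω h1 h2
    rw [h1]
    convert h2 using 5
    exact Finset.sum_congr rfl fun k _ => by congr 1; ring

/-- Merging two blocks of level `j` into one of level `j + 1` produces a martingale increment and the
projected block of the next level. -/
theorem blockProj_add [CompleteSpace H] [IsFiniteMeasure P] (h : IsCondBdd P F X M θ)
    (j l : ℕ) : ∀ᵐ ω ∂P, blockProj P F X j (2 * l) ω + blockProj P F X j (2 * l + 1) ω =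
      (blockProj P F X j (2 * l + 1) -
        P[blockProj P F X j (2 * l + 1)|F (l * 2 ^ (j + 1))]) ω + blockProj P F X (j + 1) l ω := by
  have h1 := condExp_add (h.integrable_blockSum j (2 * l)) (h.integrable_blockSum j (2 * l + 1))
    (F (l * 2 ^ (j + 1)))
  rw [← blockSum_succ] at h1
  have e : 2 * l * 2 ^ j = l * 2 ^ (j + 1) := by ring
  filter_upwards [h1, h.condExp_blockProj j l] with ω h1 h2
  rw [Pi.sub_apply, h2, blockProj, blockProj, blockProj, h1, Pi.add_apply, e]
  abel

/-- Each passage to the next level halves the number of terms, hence contributes a factor `√(1 / 2)`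
to the scale of the martingale part. -/
theorem expSqBound_blockProj [CompleteSpace H] [IsProbabilityMeasure P] (h : IsCondBdd P F X M θ)
    (N : ℕ) : ∀ j m, m < 2 ^ N → ExpSqBound P
      (fun ω => partialSups (fun k => ‖∑ l ∈ Finset.range k, blockProj P F X j l ω‖) m)
      (√m * ∑ i ∈ Finset.range N, (√(1 / 2) ^ i * ∑ k ∈ Finset.range (2 ^ (j + i)), θ k +
        √(1 / 2) ^ (i + 1) * ∑ k ∈ Finset.range (2 ^ (j + i + 1)), θ k)) := by
  have hA (i : ℕ) : 0 ≤ ∑ k ∈ Finset.range (2 ^ i), θ k := Finset.sum_nonneg fun k _ => h.nonneg k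
  induction N with
  | zero =>
    intro j m hm
    obtain rfl : m = 0 := by simpa using hm
    simpa using ExpSqBound.const (P := P) 0
  | succ N ih =>
    intro j m hm
    rcases Nat.eq_zero_or_pos m with rfl | hm0
    · simpa using ExpSqBound.const (P := P) 0
    -- The three contributions are the unpaired block, the martingale, and the next level.
    have hmart := h.isBddMartDiff_block j
    have hrec := ih (j + 1) (m / 2) (by rw [pow_succ] at hm; omega)
    have hmm := measurable_partialSups_norm_sum
      (fun k => (hmart.meas k).mono (hmart.le _)) (m / 2)
    have hS (j : ℕ) : 0 ≤ ∑ i ∈ Finset.range N,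
        (√(1 / 2) ^ i * ∑ k ∈ Finset.range (2 ^ (j + i)), θ k +
        √(1 / 2) ^ (i + 1) * ∑ k ∈ Finset.range (2 ^ (j + i + 1)), θ k) :=
      Finset.sum_nonneg fun i _ => add_nonneg (mul_nonneg (by positivity) (hA _))
        (mul_nonneg (by positivity) (hA _))
    refine ((ExpSqBound.const _).add ((hmart.expSqBound (m / 2)).add hrec
      (mul_nonneg (Real.sqrt_nonneg _) (hA _)) (mul_nonneg (Real.sqrt_nonneg _) (hS _)) hmm)
      (hA j) (add_nonneg (mul_nonneg (Real.sqrt_nonneg _) (hA _))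
        (mul_nonneg (Real.sqrt_nonneg _) (hS _))) measurable_const).mono ?_ ?_
    · filter_upwards [ae_all_iff.2 (h.blockProj_add j), ae_all_iff.2 (h.norm_blockProj_le j)]
        with ω h1 h2
      exact partialSups_norm_sum_le_of_pairs h1 h2 m
    -- A nonempty range has `1 ≤ √m`, which absorbs the unpaired block.
    · have hm1 : 1 ≤ √(m : ℝ) := Real.one_le_sqrt.2 (by exact_mod_cast hm0)
      have hhalf : √((m / 2 : ℕ) : ℝ) ≤ √m * √(1 / 2) := by
        rw [← Real.sqrt_mul (by positivity)]
        refine Real.sqrt_le_sqrt ?_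
        have := Nat.cast_div_le (α := ℝ) (m := m) (n := 2)
        push_cast at this
        linarith
      rw [Finset.sum_range_succ']
      have e : ∀ i, √(1 / 2 : ℝ) ^ (i + 1) * ∑ k ∈ Finset.range (2 ^ (j + (i + 1))), θ k +
          √(1 / 2) ^ (i + 1 + 1) * ∑ k ∈ Finset.range (2 ^ (j + (i + 1) + 1)), θ k =
          √(1 / 2) * (√(1 / 2) ^ i * ∑ k ∈ Finset.range (2 ^ (j + 1 + i)), θ k +
          √(1 / 2) ^ (i + 1) * ∑ k ∈ Finset.range (2 ^ (j + 1 + i + 1)), θ k) := by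
        intro i
        rw [show j + (i + 1) = j + 1 + i by ring]
        ring
      rw [Finset.sum_congr rfl fun i _ => e i, ← Finset.mul_sum]
      have t1 := mul_le_mul_of_nonneg_right hm1 (hA j)
      have t2 := mul_le_mul_of_nonneg_right hhalf (hA (j + 1))
      have t3 := mul_le_mul_of_nonneg_right hhalf (hS (j + 1))
      simp only [pow_zero, zero_add, pow_one, add_zero, one_mul] at *
      linarith

theorem expSqBound_sum [CompleteSpace H] [IsProbabilityMeasure P] (h : IsCondBdd P F X M θ)
    {n N : ℕ} (hn : n < 2 ^ N) : ExpSqBound P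
      (fun ω => partialSups (fun k => ‖∑ l ∈ Finset.range k, X (l + 1) ω‖) n)
      (√n * (M + 3 * ∑ i ∈ Finset.range (N + 1),
        √(1 / 2) ^ i * ∑ k ∈ Finset.range (2 ^ i), θ k)) := by
  have hA (i : ℕ) : 0 ≤ ∑ k ∈ Finset.range (2 ^ i), θ k := Finset.sum_nonneg fun k _ => h.nonneg k
  have hM : 0 ≤ M := let ⟨_, hω⟩ := (h.bound 0).exists; (norm_nonneg _).trans hω
  -- Before the first pairing, `X_{l+1}` is replaced by its projection on the immediate past.
  have hmart : IsBddMartDiff P F (fun l => X (l + 1) - P[X (l + 1)|F l]) (M + θ 0) :=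
    isBddMartDiff_sub_condExp h.mono h.le (fun k => h.meas (k + 1)) (fun k => h.bound (k + 1))
      (fun k => h.condExp_bound k 0)
  have hB (i : ℕ) : 0 ≤ √(1 / 2) ^ i * ∑ k ∈ Finset.range (2 ^ i), θ k :=
    mul_nonneg (by positivity) (hA _)
  refine ((hmart.expSqBound n).add (h.expSqBound_blockProj N 0 n hn)
    (mul_nonneg (Real.sqrt_nonneg _) (add_nonneg hM (h.nonneg 0)))
    (mul_nonneg (Real.sqrt_nonneg _) (Finset.sum_nonneg fun i _ => ?_))
    (measurable_partialSups_norm_sum (fun k => (hmart.meas k).mono (hmart.le _)) n)).mono ?_ ?_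
  · simp only [zero_add]
    exact add_nonneg (hB i) (hB (i + 1))
  · refine Filter.Eventually.of_forall fun ω => ?_
    refine le_trans (le_of_eq ?_) (partialSups_norm_sum_add_le _ _ n)
    simp [blockProj, blockSum]
  · simp only [zero_add]
    rw [← mul_add, Finset.sum_add_distrib]
    have h1 := Finset.sum_range_succ
      (fun i => √(1 / 2) ^ i * ∑ k ∈ Finset.range (2 ^ i), θ k) N
    have h2 := Finset.sum_range_succ'
      (fun i => √(1 / 2) ^ i * ∑ k ∈ Finset.range (2 ^ i), θ k) N
    have h3 : 0 ≤ ∑ i ∈ Finset.range N,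
        √(1 / 2) ^ (i + 1) * ∑ k ∈ Finset.range (2 ^ (i + 1)), θ k :=
      Finset.sum_nonneg fun i _ => hB (i + 1)
    have h4 := hB N
    simp only [pow_zero, Finset.range_one, Finset.sum_singleton, one_mul] at h2
    refine mul_le_mul_of_nonneg_left ?_ (Real.sqrt_nonneg _)
    linarith [h.nonneg 0]

end IsCondBdd
end Dyadic

/-! ### Summation over dyadic levels -/

/-- The factor `4` bounds the sum `1 / (1 - √(1 / 2))` of the geometric series. -/
theorem sum_sqrt_half_pow_le (k N : ℕ) :
    ∑ i ∈ Finset.range N with k < 2 ^ i, √(1 / 2 : ℝ) ^ i ≤ 4 * ((k : ℝ) + 1) ^ (-(1 / 2) : ℝ) := by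
  have hs0 : 0 ≤ √(1 / 2 : ℝ) := Real.sqrt_nonneg _
  have hs1 : √(1 / 2 : ℝ) ≤ 3 / 4 := Real.sqrt_le_iff.2 (by norm_num)
  set q := Nat.clog 2 (k + 1) with hq
  have hk : k + 1 ≤ 2 ^ q := Nat.le_pow_clog (by norm_num) _
  have hpow : √(1 / 2 : ℝ) ^ q ≤ ((k : ℝ) + 1) ^ (-(1 / 2) : ℝ) := by
    rw [Real.rpow_neg (by positivity), ← Real.sqrt_eq_rpow, one_div, Real.sqrt_inv, inv_pow]
    gcongr
    refine Real.sqrt_le_iff.2 ⟨by positivity, ?_⟩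
    rw [← pow_mul, mul_comm, pow_mul, Real.sq_sqrt (by norm_num)]
    exact_mod_cast hk
  calc _ ≤ ∑ i ∈ Finset.Ico q N, √(1 / 2 : ℝ) ^ i := by
        refine Finset.sum_le_sum_of_subset_of_nonneg (fun i hi => ?_) fun i _ _ => by positivity
        simp only [Finset.mem_filter, Finset.mem_range, Finset.mem_Ico] at *
        exact ⟨(Nat.clog_le_iff_le_pow (by norm_num)).2 hi.2, hi.1⟩
    _ ≤ √(1 / 2 : ℝ) ^ q / (1 - √(1 / 2)) := geom_sum_Ico_le_of_lt_one hs0 (by linarith)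
    _ ≤ 4 * √(1 / 2 : ℝ) ^ q := by
        rw [div_le_iff₀ (by linarith)]
        have : 0 ≤ √(1 / 2 : ℝ) ^ q := by positivity
        nlinarith
    _ ≤ _ := by gcongr

theorem sum_sqrt_half_pow_mul_sum_le {θ : ℕ → ℝ} (hθ : ∀ k, 0 ≤ θ k) (N : ℕ) :
    ∑ i ∈ Finset.range N, √(1 / 2 : ℝ) ^ i * ∑ k ∈ Finset.range (2 ^ i), θ k ≤
      4 * ∑ k ∈ Finset.range (2 ^ N), ((k : ℝ) + 1) ^ (-(1 / 2) : ℝ) * θ k := by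
  calc _ = ∑ i ∈ Finset.range N, ∑ k ∈ Finset.range (2 ^ N),
        if k < 2 ^ i then √(1 / 2 : ℝ) ^ i * θ k else 0 := by
        refine Finset.sum_congr rfl fun i hi => ?_
        rw [Finset.mul_sum, ← Finset.sum_filter]
        refine Finset.sum_congr ?_ fun _ _ => rfl
        ext k
        have : 2 ^ i ≤ 2 ^ N := Nat.pow_le_pow_right (by norm_num) (Finset.mem_range.1 hi).le
        simp only [Finset.mem_filter, Finset.mem_range]
        omega
    _ = ∑ k ∈ Finset.range (2 ^ N),
          (∑ i ∈ Finset.range N with k < 2 ^ i, √(1 / 2 : ℝ) ^ i) * θ k := by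
        rw [Finset.sum_comm]
        refine Finset.sum_congr rfl fun k _ => ?_
        rw [← Finset.sum_filter, Finset.sum_mul]
    _ ≤ _ := by
        rw [Finset.mul_sum]
        refine Finset.sum_le_sum fun k _ => ?_
        rw [← mul_assoc]
        exact mul_le_mul_of_nonneg_right (sum_sqrt_half_pow_le k N) (hθ k)

/-! ### Conditional expectations under `φ`-mixing -/

section Mixing
variable {Ω H : Type*} [NormedAddCommGroup H] [InnerProductSpace ℝ H]

theorem measureReal_inter_preimage_le {E : Type*} [MeasurableSpace E] (𝓕 : MeasurableSpace Ω)
    [mΩ : MeasurableSpace Ω] {P : Measure Ω} [IsProbabilityMeasure P] (h𝓕 : 𝓕 ≤ mΩ) {Y : Ω → E}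
    (hY : Measurable Y) (hφ : phiCoeff 𝓕 P Y ≠ ∞) {A : Set E} (hA : MeasurableSet A)
    {B : Set Ω} (hB : MeasurableSet[𝓕] B) :
    P.real (Y ⁻¹' A ∩ B) ≤ (P.real (Y ⁻¹' A) + (phiCoeff 𝓕 P Y).toReal) * P.real B := by
  have hle : eLpNorm (fun ω => (P⟦Y ⁻¹' A | 𝓕⟧) ω - P.real (Y ⁻¹' A)) ∞ P ≤ phiCoeff 𝓕 P Y :=
    le_iSup₂_of_le (f := fun (A : Set E) (_ : MeasurableSet A) =>
      eLpNorm (fun ω => (P⟦Y ⁻¹' A | 𝓕⟧) ω - P.real (Y ⁻¹' A)) ∞ P) A hA le_rfl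
  have hae : ∀ᵐ ω ∂P, (P⟦Y ⁻¹' A | 𝓕⟧) ω ≤ P.real (Y ⁻¹' A) + (phiCoeff 𝓕 P Y).toReal := by
    have := ae_le_eLpNormEssSup
      (f := fun ω => (P⟦Y ⁻¹' A | 𝓕⟧) ω - P.real (Y ⁻¹' A)) (μ := P)
    rw [← eLpNorm_exponent_top] at this
    filter_upwards [this] with ω hω
    have h1 := ENNReal.toReal_mono hφ (hω.trans hle)
    rw [toReal_enorm, Real.norm_eq_abs] at h1
    linarith [le_abs_self ((P⟦Y ⁻¹' A | 𝓕⟧) ω - P.real (Y ⁻¹' A))]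
  have hAm : MeasurableSet (Y ⁻¹' A) := hY hA
  have hint : ∫ ω in B, (P⟦Y ⁻¹' A | 𝓕⟧) ω ∂P = P.real (Y ⁻¹' A ∩ B) := by
    rw [setIntegral_condExp h𝓕 ((integrable_const (1 : ℝ)).indicator hAm) hB,
      integral_indicator hAm, Measure.restrict_restrict hAm]
    simp
  calc P.real (Y ⁻¹' A ∩ B) = ∫ ω in B, (P⟦Y ⁻¹' A | 𝓕⟧) ω ∂P := hint.symm
    _ ≤ ∫ ω in B, (P.real (Y ⁻¹' A) + (phiCoeff 𝓕 P Y).toReal) ∂P :=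
        integral_mono_ae integrable_condExp.integrableOn (integrable_const _)
          (ae_restrict_of_ae hae)
    _ = _ := by simp [mul_comm]

/-- A bounded centred function of `Y` has conditional expectation at most `2 L φ`. By the layer cake
formula its integral over `B` is an integral over levels `t ∈ (0, 2 L)` of probabilities, each of
which changes by at most `φ P(B)` when `Y` is decoupled from `B`. This route needs no regular
conditional distribution of `Y`. -/
theorem setIntegral_le_of_phiCoeff {E : Type*} [MeasurableSpace E] (𝓕 : MeasurableSpace Ω)
    [mΩ : MeasurableSpace Ω] {P : Measure Ω} [IsProbabilityMeasure P] (h𝓕 : 𝓕 ≤ mΩ) {Y : Ω → E}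
    (hY : Measurable Y) (hφ : phiCoeff 𝓕 P Y ≠ ∞) {g : E → ℝ} (hg : Measurable g) {L : ℝ}
    (hL : ∀ᵐ ω ∂P, |g (Y ω)| ≤ L) (h0 : ∫ ω, g (Y ω) ∂P = 0) {B : Set Ω}
    (hB : MeasurableSet[𝓕] B) :
    ∫ ω in B, g (Y ω) ∂P ≤ 2 * L * (phiCoeff 𝓕 P Y).toReal * P.real B := by
  set φ := phiCoeff 𝓕 P Y with hφd
  have hgY : Measurable fun ω => g (Y ω) := hg.comp hY
  have hgi : Integrable (fun ω => g (Y ω)) P :=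
    Integrable.of_bound hgY.aestronglyMeasurable L hL
  have hL0 : 0 ≤ L := let ⟨_, hω⟩ := hL.exists; (abs_nonneg _).trans hω
  have hnn : ∀ᵐ ω ∂P, 0 ≤ g (Y ω) + L := by
    filter_upwards [hL] with ω hω
    linarith [(abs_le.1 hω).1]
  have hnnB : ∀ᵐ ω ∂(P.restrict B), 0 ≤ g (Y ω) + L := ae_restrict_of_ae hnn
  have hi : Integrable (fun ω => g (Y ω) + L) P := hgi.add (integrable_const L)
  have hmeas (t : ℝ) : MeasurableSet {e | t < g e + L} :=
    measurableSet_lt measurable_const (hg.add_const L)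
  have hpt (t : ℝ) (ht : t ∈ Set.Ioi (0 : ℝ)) : (P.restrict B) {ω | t < g (Y ω) + L} ≤
      P {ω | t < g (Y ω) + L} * P B + (Set.Ioo 0 (2 * L)).indicator (fun _ => φ * P B) t := by
    have hYt : MeasurableSet {ω | t < g (Y ω) + L} := hY (hmeas t)
    rw [Measure.restrict_apply hYt]
    by_cases h2 : t < 2 * L
    · rw [Set.indicator_of_mem (show t ∈ Set.Ioo 0 (2 * L) from ⟨ht, h2⟩), ← add_mul]
      have := measureReal_inter_preimage_le 𝓕 h𝓕 hY hφ (hmeas t) hB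
      rw [← ENNReal.toReal_le_toReal (measure_ne_top _ _) (by finiteness), ENNReal.toReal_mul,
        ENNReal.toReal_add (by finiteness) hφ]
      exact this
    -- Levels above `2 L` are never exceeded.
    · have : P {ω | t < g (Y ω) + L} = 0 := by
        refine measure_eq_zero_iff_ae_notMem.2 ?_
        filter_upwards [hL] with ω hω
        exact fun hlt : t < g (Y ω) + L => by linarith [(abs_le.1 hω).2]
      exact (measure_mono_null Set.inter_subset_left this).le.trans zero_le
  have key : ∫⁻ ω in B, ENNReal.ofReal (g (Y ω) + L) ∂P ≤
      ENNReal.ofReal L * P B + φ * P B * ENNReal.ofReal (2 * L) := by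
    calc ∫⁻ ω in B, ENNReal.ofReal (g (Y ω) + L) ∂P
        = ∫⁻ t in Set.Ioi 0, (P.restrict B) {ω | t < g (Y ω) + L} :=
          lintegral_eq_lintegral_meas_lt _ hnnB (hgY.add_const L).aemeasurable
      _ ≤ ∫⁻ t in Set.Ioi 0, (P {ω | t < g (Y ω) + L} * P B +
            (Set.Ioo 0 (2 * L)).indicator (fun _ => φ * P B) t) :=
          setLIntegral_mono' measurableSet_Ioi hpt
      _ = (∫⁻ t in Set.Ioi 0, P {ω | t < g (Y ω) + L}) * P B +
            φ * P B * ENNReal.ofReal (2 * L) := by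
          rw [lintegral_add_right _ (by fun_prop (disch := measurability)),
            lintegral_mul_const' _ _ (measure_ne_top _ _), lintegral_indicator measurableSet_Ioo,
            Measure.restrict_restrict measurableSet_Ioo,
            Set.inter_eq_left.2 Set.Ioo_subset_Ioi_self]
          simp
      _ = _ := by
          rw [← lintegral_eq_lintegral_meas_lt _ hnn (hgY.add_const L).aemeasurable,
            ← ofReal_integral_eq_lintegral_ofReal hi hnn, integral_add hgi (integrable_const L), h0]
          simp
  rw [← ofReal_integral_eq_lintegral_ofReal hi.integrableOn hnnB,
    ENNReal.ofReal_le_iff_le_toReal (by finiteness),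
    integral_add hgi.integrableOn (integrable_const L), ENNReal.toReal_add (by finiteness)
    (by finiteness), ENNReal.toReal_mul, ENNReal.toReal_mul, ENNReal.toReal_mul,
    ENNReal.toReal_ofReal hL0, ENNReal.toReal_ofReal (by positivity)] at key
  simp only [integral_const, smul_eq_mul, measureReal_restrict_apply_univ] at key
  simp only [Measure.real] at key ⊢
  linarith

theorem norm_condExp_le_of_setIntegral_inner_le [CompleteSpace H]
    [TopologicalSpace.SeparableSpace H] {m mΩ : MeasurableSpace Ω} {P : Measure Ω}
    [IsFiniteMeasure P] (hm : m ≤ mΩ) {Y : Ω → H} (hY : Integrable Y P) {θ : ℝ} (hθ : 0 ≤ θ)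
    (h : ∀ B, MeasurableSet[m] B → ∀ u : H, ∫ ω in B, inner ℝ u (Y ω) ∂P ≤ θ * ‖u‖ * P.real B) :
    ∀ᵐ ω ∂P, ‖(P[Y|m]) ω‖ ≤ θ := by
  have hu (u : H) : ∀ᵐ ω ∂P, inner ℝ u ((P[Y|m]) ω) ≤ θ * ‖u‖ := by
    have hsm : StronglyMeasurable[m] fun ω => inner ℝ u ((P[Y|m]) ω) :=
      (innerSL ℝ u).continuous.comp_stronglyMeasurable stronglyMeasurable_condExp
    have hi : Integrable (fun ω => inner ℝ u ((P[Y|m]) ω)) P :=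
      (innerSL ℝ u).integrable_comp integrable_condExp
    refine ae_le_of_ae_le_trim (hm := hm) (ae_le_of_forall_setIntegral_le (hi.trim hm hsm)
      (integrable_const _) fun B hB _ => ?_)
    rw [← setIntegral_trim hm hsm hB]
    calc ∫ ω in B, inner ℝ u ((P[Y|m]) ω) ∂P = inner ℝ u (∫ ω in B, (P[Y|m]) ω ∂P) :=
          integral_inner integrable_condExp.integrableOn u
      _ = ∫ ω in B, inner ℝ u (Y ω) ∂P := by
          rw [setIntegral_condExp hm hY hB]
          exact (integral_inner hY.integrableOn u).symm
      _ ≤ θ * ‖u‖ * P.real B := h B hB u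
      _ = _ := by
          simp [Measure.real, trim_measurableSet_eq hm hB, mul_comm]
  have hall := ae_all_iff.2 fun n => hu (TopologicalSpace.denseSeq H n)
  filter_upwards [hall] with ω hω
  set z := (P[Y|m]) ω
  have hz : inner ℝ z z ≤ θ * ‖z‖ := by
    refine (TopologicalSpace.denseRange_denseSeq H).induction_on
      (p := fun u => inner ℝ u z ≤ θ * ‖u‖) z ?_ hω
    exact isClosed_le (by fun_prop) (by fun_prop)
  rw [real_inner_self_eq_norm_sq, sq] at hz
  rcases (norm_nonneg z).eq_or_lt with h0 | h0
  · rwa [← h0]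
  · exact le_of_mul_le_mul_right hz h0

end Mixing

/-! ### Stationary sequences -/

theorem seq_natCast {Ω H : Type*} [MeasurableSpace Ω] (T : Ω ≃ᵐ Ω) (X₀ : Ω → H) (i : ℕ) :
    seq T X₀ (i : ℤ) = X₀ ∘ T^[i] := by
  funext ω
  simp only [seq, zpow_natCast, Function.comp_apply]
  rw [← Equiv.Perm.iterate_eq_pow]
  rfl

section Stationary
variable {Ω H : Type*} [NormedAddCommGroup H] [InnerProductSpace ℝ H]

/-- Stationarity transports the bound on `E(X_{k+1} | F_0)` to `E(X_{m+k+1} | F_m)`, where `F_m` is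
the preimage of `F_0` under `T ^ m`. -/
theorem isCondBdd_seq [CompleteSpace H] [TopologicalSpace.SeparableSpace H] [MeasurableSpace H]
    [BorelSpace H] (𝓕₀ : MeasurableSpace Ω) [mΩ : MeasurableSpace Ω] {P : Measure Ω}
    [IsProbabilityMeasure P] {T : Ω ≃ᵐ Ω} (hT : MeasurePreserving T P P) (h𝓕₀ : 𝓕₀ ≤ mΩ)
    (h𝓕₀T : 𝓕₀ ≤ MeasurableSpace.comap T 𝓕₀) {X₀ : Ω → H} (hX₀ : Measurable[𝓕₀] X₀)
    (hbdd : eLpNorm X₀ ∞ P < ∞) (hcent : ∫ ω, X₀ ω ∂P = 0)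
    (hφ : ∀ k : ℕ, phiOne 𝓕₀ P T X₀ (k + 1) ≠ ∞) :
    IsCondBdd P (fun m => MeasurableSpace.comap (T^[m]) 𝓕₀) (fun k : ℕ => seq T X₀ (k : ℤ))
      (eLpNorm X₀ ∞ P).toReal
      (fun k => 2 * (eLpNorm X₀ ∞ P).toReal * (phiOne 𝓕₀ P T X₀ (k + 1)).toReal) := by
  set M := (eLpNorm X₀ ∞ P).toReal with hM
  have hXm : Measurable X₀ := hX₀.mono h𝓕₀ le_rfl
  have hTm (m : ℕ) : MeasurePreserving (T^[m]) P P := hT.iterate m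
  have hle (m : ℕ) : MeasurableSpace.comap (T^[m]) 𝓕₀ ≤ mΩ := by
    rintro _ ⟨B, hB, rfl⟩
    exact (hTm m).measurable (h𝓕₀ B hB)
  have hb0 : ∀ᵐ ω ∂P, ‖X₀ ω‖ ≤ M := by
    have := ae_le_eLpNormEssSup (f := X₀) (μ := P)
    rw [← eLpNorm_exponent_top] at this
    filter_upwards [this] with ω hω
    rw [← toReal_enorm]
    exact ENNReal.toReal_mono hbdd.ne hω
  have hb (k : ℕ) : ∀ᵐ ω ∂P, ‖seq T X₀ (k : ℤ) ω‖ ≤ M := by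
    rw [seq_natCast]
    exact (hTm k).quasiMeasurePreserving.ae hb0
  have hsm (k : ℕ) : Measurable (seq T X₀ (k : ℤ)) := by
    rw [seq_natCast]
    exact hXm.comp (hTm k).measurable
  have hi (k : ℕ) : Integrable (seq T X₀ (k : ℤ)) P :=
    Integrable.of_bound (hsm k).aestronglyMeasurable M (hb k)
  have hcent' (k : ℕ) : ∫ ω, seq T X₀ (k : ℤ) ω ∂P = 0 := by
    rw [seq_natCast, ← hcent]
    conv_rhs => rw [← (hTm k).map_eq]
    exact (integral_map (hTm k).measurable.aemeasurable hXm.aestronglyMeasurable).symm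
  refine ⟨monotone_nat_of_le_succ fun m => ?_, hle, fun k => ?_, hb, fun m k => ?_⟩
  · rw [Function.iterate_succ', ← MeasurableSpace.comap_comp]
    exact MeasurableSpace.comap_mono h𝓕₀T
  · rw [seq_natCast]
    exact (hX₀.comp (comap_measurable _)).stronglyMeasurable
  · refine norm_condExp_le_of_setIntegral_inner_le (hle m) (hi _) (by positivity) ?_
    rintro _ ⟨B, hB, rfl⟩ u
    have hinner : Measurable fun y : H => inner ℝ u y := by fun_prop
    have hshift : ∫ ω in T^[m] ⁻¹' B, inner ℝ u (seq T X₀ ((m + k + 1 : ℕ) : ℤ) ω) ∂P =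
        ∫ ω in B, inner ℝ u (seq T X₀ ((k + 1 : ℕ) : ℤ) ω) ∂P := by
      conv_rhs => rw [← (hTm m).map_eq]
      refine Eq.trans ?_ (setIntegral_map (h𝓕₀ B hB)
        (hinner.comp (hsm (k + 1))).aestronglyMeasurable (hTm m).measurable.aemeasurable).symm
      rw [seq_natCast, seq_natCast, add_assoc, add_comm m, Function.iterate_add]
      rfl
    rw [hshift, (hTm m).measureReal_preimage (h𝓕₀ B hB).nullMeasurableSet]
    refine (setIntegral_le_of_phiCoeff 𝓕₀ h𝓕₀ (hsm (k + 1)) (hφ k) hinner (L := M * ‖u‖) ?_ ?_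
      hB).trans_eq ?_
    · filter_upwards [hb (k + 1)] with ω hω
      calc _ ≤ ‖u‖ * ‖seq T X₀ ((k + 1 : ℕ) : ℤ) ω‖ := abs_real_inner_le_norm _ _
        _ ≤ ‖u‖ * M := by gcongr
        _ = _ := mul_comm _ _
    · rw [integral_inner (hi (k + 1)), hcent', inner_zero_right]
    · rw [phiOne]; ring

end Stationary
/-! ### The maximal inequality -/

/-- A tail `8 exp (-2 y)`, capped at `1`, is below `2 √e exp (-y)`: when the latter is less than `1`,
`exp (-y) < 1 / (2 √e)` and `8 / (2 √e) ≤ 2 √e`. -/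
theorem le_two_mul_sqrt_exp_one_mul {p y : ℝ} (hp : p ≤ 1) (h : p ≤ 8 * Real.exp (-(2 * y))) :
    p ≤ 2 * √(Real.exp 1) * Real.exp (-y) := by
  set s := √(Real.exp 1) with hs
  set q := Real.exp (-y) with hq
  have hs2 : s ^ 2 = Real.exp 1 := Real.sq_sqrt (Real.exp_pos _).le
  have he : 2 ≤ s ^ 2 := by rw [hs2]; linarith [Real.exp_one_gt_d9]
  have hq0 : 0 < q := Real.exp_pos _
  have hs0 : 0 < s := Real.sqrt_pos.2 (Real.exp_pos _)
  have h2 : Real.exp (-(2 * y)) = q ^ 2 := by rw [hq, ← Real.exp_nat_mul]; congr 1; push_cast; ring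
  rw [h2] at h
  by_cases h1 : 1 ≤ 2 * s * q
  · linarith
  · push Not at h1
    refine h.trans ?_
    have h3 : 4 * q ≤ s := by
      have : 2 * s * q * s ≤ s := by nlinarith
      nlinarith
    nlinarith

theorem one_le_two_mul_sqrt_exp_one : 1 ≤ ENNReal.ofReal (2 * √(Real.exp 1)) := by
  rw [ENNReal.one_le_ofReal]
  have : 1 ≤ √(Real.exp 1) := Real.one_le_sqrt.2 (by linarith [Real.exp_one_gt_d9])
  linarith

theorem four_le_hoeffdingConst : 4 ≤ hoeffdingConst := by
  refine le_max_of_le_left ?_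
  have : 1 ≤ √2 := Real.one_le_sqrt.2 (by norm_num)
  linarith

theorem partialSum_eq {Ω H : Type*} [MeasurableSpace Ω] [AddCommMonoid H] (T : Ω ≃ᵐ Ω)
    (X₀ : Ω → H) (i : ℕ) (ω : Ω) :
    partialSum T X₀ i ω = ∑ l ∈ Finset.range i, seq T X₀ ((l + 1 : ℕ) : ℤ) ω := by
  rw [partialSum, Finset.range_eq_Ico, Finset.sum_Ico_add' (fun l : ℕ => seq T X₀ (l : ℤ) ω) 0 i 1]
  rfl

/-- The maximal inequality in the non-degenerate case, with a bound in real numbers. -/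
theorem measure_max_ge_le_of_phiSeries_ne_top {Ω H : Type*}
    [NormedAddCommGroup H] [InnerProductSpace ℝ H] [CompleteSpace H]
    [TopologicalSpace.SeparableSpace H] [MeasurableSpace H] [BorelSpace H]
    (𝓕₀ : MeasurableSpace Ω) [mΩ : MeasurableSpace Ω]
    (P : Measure Ω) [IsProbabilityMeasure P]
    (T : Ω ≃ᵐ Ω) (hT : MeasurePreserving T P P)
    (h𝓕₀ : 𝓕₀ ≤ mΩ) (h𝓕₀T : 𝓕₀ ≤ MeasurableSpace.comap T 𝓕₀)
    (X₀ : Ω → H) (hX₀ : Measurable[𝓕₀] X₀)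
    (hbdd : eLpNorm X₀ ∞ P < ∞) (hcent : ∫ ω, X₀ ω ∂P = 0)
    (n : ℕ) (hn : 1 ≤ n) (x : ℝ) (hx : 0 ≤ x) (hM : eLpNorm X₀ ∞ P ≠ 0)
    (hΦ : phiSeries 𝓕₀ P T X₀ ≠ ∞) :
    P {ω | x ≤ (Finset.Icc 1 n).sup' (Finset.nonempty_Icc.2 hn)
        (fun i => ‖partialSum T X₀ i ω‖)} ≤
      ENNReal.ofReal (2 * √(Real.exp 1) * Real.exp (-(x ^ 2 / (4 * n *
        (eLpNorm X₀ ∞ P).toReal ^ 2 *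
          (1 + 6 * hoeffdingConst * (phiSeries 𝓕₀ P T X₀).toReal) ^ 2)))) := by
  set M := (eLpNorm X₀ ∞ P).toReal with hMd
  set Φ := (phiSeries 𝓕₀ P T X₀).toReal with hΦd
  have hM0 : 0 < M := ENNReal.toReal_pos hM hbdd.ne
  have hΦ0 : 0 ≤ Φ := ENNReal.toReal_nonneg
  have hC := four_le_hoeffdingConst
  have hw (k : ℕ) : 0 < ((k : ℝ) + 1) ^ (-(1 / 2) : ℝ) := by positivity
  have hφ (k : ℕ) : phiOne 𝓕₀ P T X₀ (k + 1) ≠ ∞ := by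
    intro h
    refine ENNReal.ne_top_of_tsum_ne_top hΦ k ?_
    rw [h, ENNReal.mul_top]
    simpa using hw k
  have hsum (r : ℕ) : ∑ k ∈ Finset.range r, ((k : ℝ) + 1) ^ (-(1 / 2) : ℝ) *
      (phiOne 𝓕₀ P T X₀ (k + 1)).toReal ≤ Φ := by
    have h := ENNReal.toReal_mono hΦ (ENNReal.sum_le_tsum (f := fun j : ℕ =>
      ENNReal.ofReal (((j + 1 : ℕ) : ℝ) ^ (-(1 / 2) : ℝ)) * phiOne 𝓕₀ P T X₀ (j + 1))
      (Finset.range r))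
    rw [ENNReal.toReal_sum fun k _ => ENNReal.mul_ne_top ENNReal.ofReal_ne_top (hφ k)] at h
    refine le_trans (le_of_eq (Finset.sum_congr rfl fun k _ => ?_)) h
    rw [ENNReal.toReal_mul, ENNReal.toReal_ofReal (by positivity)]
    push_cast
    rfl
  have hcb := isCondBdd_seq 𝓕₀ hT h𝓕₀ h𝓕₀T hX₀ hbdd hcent hφ
  -- The decomposition gives the constant `24 = 3 · 4 · 2`, which is at most `6 C`.
  have hσ : √n * (M + 3 * ∑ i ∈ Finset.range (n + 1), √(1 / 2) ^ i *
      ∑ k ∈ Finset.range (2 ^ i), 2 * M * (phiOne 𝓕₀ P T X₀ (k + 1)).toReal) ≤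
      √n * (M * (1 + 6 * hoeffdingConst * Φ)) := by
    refine mul_le_mul_of_nonneg_left ?_ (Real.sqrt_nonneg _)
    have h1 := sum_sqrt_half_pow_mul_sum_le
      (θ := fun k => 2 * M * (phiOne 𝓕₀ P T X₀ (k + 1)).toReal) (fun k => by positivity) (n + 1)
    have h2 : ∑ k ∈ Finset.range (2 ^ (n + 1)), ((k : ℝ) + 1) ^ (-(1 / 2) : ℝ) *
        (2 * M * (phiOne 𝓕₀ P T X₀ (k + 1)).toReal) ≤ 2 * M * Φ := by
      refine le_trans (le_of_eq ?_) (mul_le_mul_of_nonneg_left (hsum (2 ^ (n + 1)))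
        (by positivity : 0 ≤ 2 * M))
      rw [Finset.mul_sum]
      exact Finset.sum_congr rfl fun k _ => by ring
    have h3 : 24 * (M * Φ) ≤ 6 * hoeffdingConst * (M * Φ) := by gcongr; linarith
    linarith
  have hn0 : (0 : ℝ) < n := by exact_mod_cast hn
  have hB : 0 < √n * (M * (1 + 6 * hoeffdingConst * Φ)) := by positivity
  have hE := (hcb.expSqBound_sum n.lt_two_pow_self).mono (Filter.Eventually.of_forall
    fun ω => le_rfl) hσ
  have htail := hE.measure_ge_le hB (measurable_partialSups_norm_sum
    (fun k => (hcb.meas (k + 1)).mono (hcb.le _)) n) hx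
  have hsub : {ω | x ≤ (Finset.Icc 1 n).sup' (Finset.nonempty_Icc.2 hn)
      (fun i => ‖partialSum T X₀ i ω‖)} ⊆ {ω | x ≤ partialSups
        (fun k => ‖∑ l ∈ Finset.range k, seq T X₀ ((l + 1 : ℕ) : ℤ) ω‖) n} := by
    intro ω hω
    rw [Set.mem_ofPred_eq] at hω ⊢
    refine le_trans hω (Finset.sup'_le _ _ fun i hi => ?_)
    rw [partialSum_eq]
    exact le_partialSups_of_le (fun k => ‖∑ l ∈ Finset.range k, seq T X₀ ((l + 1 : ℕ) : ℤ) ω‖)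
      (Finset.mem_Icc.1 hi).2
  rw [← ENNReal.ofReal_toReal (measure_ne_top P _)]
  refine ENNReal.ofReal_le_ofReal (le_two_mul_sqrt_exp_one_mul
    (ENNReal.toReal_le_of_le_ofReal zero_le_one (by simpa using prob_le_one)) ?_)
  refine ENNReal.toReal_le_of_le_ofReal (by positivity)
    ((measure_mono hsub).trans (htail.trans_eq ?_))
  congr 4
  rw [mul_pow, Real.sq_sqrt hn0.le]
  field_simp
  ring

end PhiMixing

open PhiMixing in
theorem mainTheorem11 {Ω H : Type*}
    [NormedAddCommGroup H] [InnerProductSpace ℝ H] [CompleteSpace H]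
    [TopologicalSpace.SeparableSpace H] [MeasurableSpace H] [BorelSpace H]
    (𝓕₀ : MeasurableSpace Ω) [mΩ : MeasurableSpace Ω]
    (P : Measure Ω) [IsProbabilityMeasure P]
    (T : Ω ≃ᵐ Ω) (hT : MeasurePreserving T P P)
    (h𝓕₀ : 𝓕₀ ≤ mΩ) (h𝓕₀T : 𝓕₀ ≤ MeasurableSpace.comap T 𝓕₀)
    (X₀ : Ω → H) (hX₀ : Measurable[𝓕₀] X₀)
    (hbdd : eLpNorm X₀ ∞ P < ∞) (hcent : ∫ ω, X₀ ω ∂P = 0)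
    (n : ℕ) (hn : 1 ≤ n) (x : ℝ) (hx : 0 ≤ x) :
    P {ω | x ≤ (Finset.Icc 1 n).sup' (Finset.nonempty_Icc.2 hn)
        (fun i => ‖PhiMixing.partialSum T X₀ i ω‖)} ≤
      ENNReal.ofReal (2 * √(Real.exp 1)) *
        EReal.exp (-((ENNReal.ofReal (x ^ 2) /
          (4 * (n : ℝ≥0∞) * eLpNorm X₀ ∞ P ^ 2 *
            (1 + 6 * ENNReal.ofReal PhiMixing.hoeffdingConst *
              PhiMixing.phiSeries 𝓕₀ P T X₀) ^ 2) : ℝ≥0∞) : EReal)) := by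
  have hC := four_le_hoeffdingConst
  have hn0 : (0 : ℝ) < n := by exact_mod_cast hn
  -- If the exponent vanishes, the bound is at least `1`.
  have htriv : ENNReal.ofReal (x ^ 2) / (4 * (n : ℝ≥0∞) * eLpNorm X₀ ∞ P ^ 2 *
      (1 + 6 * ENNReal.ofReal hoeffdingConst * phiSeries 𝓕₀ P T X₀) ^ 2) = 0 →
      P {ω | x ≤ (Finset.Icc 1 n).sup' (Finset.nonempty_Icc.2 hn)
        (fun i => ‖partialSum T X₀ i ω‖)} ≤
      ENNReal.ofReal (2 * √(Real.exp 1)) *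
        EReal.exp (-((ENNReal.ofReal (x ^ 2) /
          (4 * (n : ℝ≥0∞) * eLpNorm X₀ ∞ P ^ 2 *
            (1 + 6 * ENNReal.ofReal hoeffdingConst *
              phiSeries 𝓕₀ P T X₀) ^ 2) : ℝ≥0∞) : EReal)) := fun h => by
    rw [h]
    simpa using prob_le_one.trans one_le_two_mul_sqrt_exp_one
  -- If `X₀ = 0` almost surely, the series may be infinite, but `0 * ∞ = 0` in the denominator.
  rcases eq_or_ne (eLpNorm X₀ ∞ P) 0 with hM | hM
  · rcases hx.eq_or_lt with rfl | hx0
    · exact htriv (by simp)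
    have hX0 : X₀ =ᵐ[P] 0 := (eLpNorm_eq_zero_iff
      (hX₀.mono h𝓕₀ le_rfl).aestronglyMeasurable (by simp)).1 hM
    have hXk (k : ℕ) : ∀ᵐ ω ∂P, seq T X₀ (k : ℤ) ω = 0 := by
      rw [seq_natCast]
      exact (hT.iterate k).quasiMeasurePreserving.ae hX0
    refine le_of_eq_of_le (measure_eq_zero_iff_ae_notMem.2 ?_) zero_le
    filter_upwards [ae_all_iff.2 hXk] with ω hω
    simp [partialSum, hω, hx0]
  rcases eq_or_ne (phiSeries 𝓕₀ P T X₀) ∞ with hΦ | hΦ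
  · refine htriv ?_
    have h1 : ENNReal.ofReal hoeffdingConst ≠ 0 := by simpa using by linarith
    have h2 : (n : ℝ≥0∞) ≠ 0 := by exact_mod_cast hn0.ne'
    rw [hΦ, ENNReal.mul_top (by simp [h1]), add_top, ENNReal.top_pow two_ne_zero,
      ENNReal.mul_top (mul_ne_zero (mul_ne_zero four_ne_zero h2) (pow_ne_zero 2 hM)),
      ENNReal.div_top]
  refine (measure_max_ge_le_of_phiSeries_ne_top 𝓕₀ P T hT h𝓕₀ h𝓕₀T X₀ hX₀ hbdd hcent n hn x hx hM
    hΦ).trans_eq ?_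
  have hM0 : 0 < (eLpNorm X₀ ∞ P).toReal := ENNReal.toReal_pos hM hbdd.ne
  have hΦ0 : 0 ≤ (phiSeries 𝓕₀ P T X₀).toReal := ENNReal.toReal_nonneg
  have hden : 4 * (n : ℝ≥0∞) * eLpNorm X₀ ∞ P ^ 2 *
      (1 + 6 * ENNReal.ofReal hoeffdingConst * phiSeries 𝓕₀ P T X₀) ^ 2 =
      ENNReal.ofReal (4 * n * (eLpNorm X₀ ∞ P).toReal ^ 2 *
          (1 + 6 * hoeffdingConst * (phiSeries 𝓕₀ P T X₀).toReal) ^ 2) := by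
    rw [ENNReal.ofReal_mul (by positivity), ENNReal.ofReal_mul (by positivity),
      ENNReal.ofReal_mul (by positivity), ENNReal.ofReal_pow (by positivity),
      ENNReal.ofReal_pow (by positivity), ENNReal.ofReal_add (by positivity) (by positivity),
      ENNReal.ofReal_mul (by positivity), ENNReal.ofReal_mul (by positivity),
      ENNReal.ofReal_toReal hbdd.ne, ENNReal.ofReal_toReal hΦ]
    simp
  rw [hden, ← ENNReal.ofReal_div_of_pos (by positivity), EReal.coe_ennreal_ofReal,
    max_eq_left (by positivity), ← EReal.coe_neg, EReal.exp_coe,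
    ← ENNReal.ofReal_mul (by positivity)]
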